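/- A \emph{slice} of a $3$-polytope $P\subset\mathbb{R}^3$ is a nonempty intersection $H\cap P$ with a plane $H$. The \emph{vertex slice sequence} $VSS(P)$ is the set of the numbers of vertices of the slices of $P$, and $\nu(P)$ is its maximum. A \emph{gap} of $P$ is an integer $m$ with $1\le m\le\nu(P)$ and $m\notin VSS(P)$. A graph is $k$-connected if it has more than $k$ vertices and stays connected whenever fewer than $k$ vertices are deleted. For a polytope $P$, let $\sigma(P)$ denote any polytope obtained by stacking a pyramid on every facet of $P$: the facets $F$ of $P$ are treated one after the other, each exactly once, and for each of them one adds a new vertex that lies strictly beyond $F$ and strictly beneath all the other facets of the polytope constructed so far, and takes the convex hull. **Theorem.** There are infinitely many, pairwise combinatorially inequivalent, $3$-polytopes whose $1$-skeleton is $3$-connected but not $4$-connected and which have at least one gap. More precisely, let $T$ be any tetrahedron. Then for every $n\ge 0$ there is an iterate $\sigma^n(T)$. For every $n\ge1$ and all choices of the new vertices, $\sigma^n(T)$ is a $3$-polytope whose $1$-skeleton is $3$-connected but not $4$-connected, and $4$ is a gap of $\sigma^n(T)$. Moreover, for $m\ne n$, an iterate $\sigma^m(T)$ is never combinatorially equivalent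 to an iterate $\sigma^n(T)$. -/

import Mathlib

namespace SlicePolytope

/-- Euclidean `d`-space. -/
abbrev Space (d : ℕ) : Type := EuclideanSpace ℝ (Fin d)

/-- A (convex) `d`-polytope in `ℝ^d`: the convex hull of finitely many points, of full dimension. -/
def IsPolytope {d : ℕ} (P : Set (Space d)) : Prop :=
  (∃ S : Set (Space d), S.Finite ∧ P = convexHull ℝ S) ∧ affineSpan ℝ P = ⊤

/-- The vertices of a polytope (or of one of its slices). -/
def vertices {d : ℕ} (P : Set (Space d)) : Set (Space d) := P.extremePoints ℝ

/-- The faces of a polytope, including the empty face and the polytope itself;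
as a subtype of `Set (Space d)` it is ordered by inclusion. -/
def faces {d : ℕ} (P : Set (Space d)) : Set (Set (Space d)) := {F | IsExposed ℝ P F}

/-- A facet of a `d`-polytope: a nonempty face of dimension `d - 1`. -/
def IsFacet {d : ℕ} (P F : Set (Space d)) : Prop :=
  F ∈ faces P ∧ F.Nonempty ∧ Module.finrank ℝ (vectorSpan ℝ F) + 1 = d

/-- Combinatorial equivalence: the face lattices are isomorphic. -/
def CombEquiv {d : ℕ} (P Q : Set (Space d)) : Prop := Nonempty (faces P ≃o faces Q)

/-- The `1`-skeleton (graph) of a polytope: the vertices, two distinct ones being adjacent when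
the segment between them is a face. -/
def skeleton {d : ℕ} (P : Set (Space d)) : SimpleGraph (vertices P) where
  Adj u v := u ≠ v ∧ segment ℝ (u : Space d) (v : Space d) ∈ faces P
  symm := ⟨fun u v h => ⟨h.1.symm, by rw [segment_symm]; exact h.2⟩⟩
  loopless := ⟨fun _ h => h.1 rfl⟩

/-- `k`-connectedness of a graph: it has more than `k` vertices, and it stays connected when
fewer than `k` vertices are deleted. -/
def IsKConnected {V : Type*} (G : SimpleGraph V) (k : ℕ) : Prop :=
  (k : ℕ∞) < ENat.card V ∧
    ∀ S : Finset V, S.card < k → (G.induce ((S : Set V)ᶜ)).Connected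

/-- Affine hyperplanes of `ℝ^d`. -/
def IsHyperplane {d : ℕ} (H : Set (Space d)) : Prop :=
  ∃ (l : Space d →L[ℝ] ℝ) (c : ℝ), l ≠ 0 ∧ H = {x | l x = c}

/-- The vertex slice sequence of `P`: all the numbers of vertices of slices `H ∩ P`, where `H` is
a hyperplane that meets `P`. -/
def VSS {d : ℕ} (P : Set (Space d)) : Set ℕ :=
  {k | ∃ H : Set (Space d), IsHyperplane H ∧ (H ∩ P).Nonempty ∧ k = (vertices (H ∩ P)).ncard}

/-- `m` is a gap of `P`: it lies between `1` and the maximal number `ν` of vertices of a slice of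
`P`, but no slice of `P` has exactly `m` vertices. -/
def IsGap {d : ℕ} (P : Set (Space d)) (m : ℕ) : Prop :=
  ∃ ν : ℕ, IsGreatest (VSS P) ν ∧ 1 ≤ m ∧ m ≤ ν ∧ m ∉ VSS P

/-- The inequality `l x ≤ c` is valid on `P`, and it is an equality on `P` exactly on `F`. -/
def Supports {d : ℕ} (P F : Set (Space d)) (l : Space d →L[ℝ] ℝ) (c : ℝ) : Prop :=
  (∀ x ∈ P, l x ≤ c) ∧ F = {x ∈ P | l x = c}

/-- `v` lies strictly beyond the facet `F` of the polytope `P`: the hyperplane spanned by `F`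
strictly separates `v` from the interior of `P`. -/
def IsBeyond {d : ℕ} (P F : Set (Space d)) (v : Space d) : Prop :=
  ∃ (l : Space d →L[ℝ] ℝ) (c : ℝ), Supports P F l c ∧ c < l v

/-- `v` lies strictly beneath the facet `F` of the polytope `P`: it lies on the same open side
of the hyperplane spanned by `F` as the interior of `P`. -/
def IsBeneath {d : ℕ} (P F : Set (Space d)) (v : Space d) : Prop :=
  ∃ (l : Space d →L[ℝ] ℝ) (c : ℝ), Supports P F l c ∧ l v < c

/-- `Q` arises from `P` by stacking a pyramid on the facets in the list, one after the other: the
new vertex lies strictly beyond the facet in question and strictly beneath all the other facets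
of the polytope constructed so far, and one passes to the convex hull. -/
def IsStackingAlong {d : ℕ} : List (Set (Space d)) → Set (Space d) → Set (Space d) → Prop
  | [], P, Q => Q = P
  | F :: L, P, Q => IsFacet P F ∧ ∃ v : Space d, IsBeyond P F v ∧
      (∀ G, IsFacet P G → G ≠ F → IsBeneath P G v) ∧
      IsStackingAlong L (convexHull ℝ (insert v P)) Q

/-- `Q` is an all-facets stacked polytope `σ(P)` induced by `P`: it arises by stacking a pyramid
on every facet of `P`, exactly once. -/
def IsAllFacetsStacking {d : ℕ} (P Q : Set (Space d)) : Prop :=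
  ∃ L : List (Set (Space d)), L.Nodup ∧ (∀ F, F ∈ L ↔ IsFacet P F) ∧ IsStackingAlong L P Q

/-- `Q` is an `n`-th iterate `σ^n(P)`. -/
def IsIteratedStacking {d : ℕ} : ℕ → Set (Space d) → Set (Space d) → Prop
  | 0, P, Q => Q = P
  | n + 1, P, Q => ∃ R, IsIteratedStacking n P R ∧ IsAllFacetsStacking R Q

/-- A (nondegenerate, solid) tetrahedron in `ℝ^3`. -/
def IsTetrahedron (T : Set (Space 3)) : Prop :=
  ∃ p : Fin 4 → Space 3, AffineIndependent ℝ p ∧ T = convexHull ℝ (Set.range p)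

end SlicePolytope

/-! Let `Q` arise from `P` by stacking on every facet. The heart is a dichotomy for planes `H`: the
slice of `Q` has at most 3 or at least 5 vertices (`ncard_le_three_or_five_le`).

If `H` crosses an edge `uw` of `P` in its interior, then `uw` is still an edge of `Q`, and `u`, `w`
have four common neighbours there: the third vertices of the two facets at `uw` and the two apices
over them. The edge gives one vertex of the slice and each common neighbour another, so there are at
least 5 (`card_add_one_le_ncard`). If `H` strictly separates vertices of `P` but crosses no edge, it
contains three pairwise adjacent vertices, by induction over the stackings
(`crossesEdgeOrTriangle_stack`), and the slice is their triangle. If `H` does not strictly separate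
vertices of `P`, it cuts off a single apex in a triangle or supports `Q` in a face. Slices with at
least 5 vertices exist, so 4 is a gap.

Stacking preserves 3-connectedness, because the new vertex has three neighbours. An apex has no
further neighbours after the round, so 4-connectedness fails. A polytope with `V` vertices and `2V -
4` facets gets `3V - 4` vertices in a round, so different iterates have different numbers of
vertices, that is, of atoms of the face lattice.

The geometry is carried by `IsSimplicial`: a triangulation, a supporting functional for each facet,
and the description by half-spaces. `IsSimplicial.stack` shows that stacking preserves it. -/

namespace SlicePolytope

/-! ### Stacking on abstract triangulations. -/

section Combinatorics

variable {α : Type*}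

/-- Two vertices that lie in a common facet. -/
def Linked (F : Finset (Finset α)) (u w : α) : Prop := ∃ t ∈ F, u ∈ t ∧ w ∈ t

lemma Linked.symm {F : Finset (Finset α)} {u w : α} (h : Linked F u w) : Linked F w u := by
  obtain ⟨t, ht, hu, hw⟩ := h
  exact ⟨t, ht, hw, hu⟩

variable [DecidableEq α]

/-- The triangles of the pyramid with apex `v` over the boundary of the triangle `t`. -/
def coneFacets (t : Finset α) (v : α) : Finset (Finset α) := t.image fun a => insert v (t.erase a)

/-- Stacking on the facet `t` of a simplicial complex, with new vertex `v`. -/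
def stackFacets (F : Finset (Finset α)) (t : Finset α) (v : α) : Finset (Finset α) :=
  F.erase t ∪ coneFacets t v

/-- The combinatorial part of being the boundary complex of a simplicial `3`-polytope. -/
structure IsTriangulation (V : Finset α) (F : Finset (Finset α)) : Prop where
  subset : ∀ t ∈ F, t ⊆ V
  card_facet : ∀ t ∈ F, t.card = 3
  neighbor : ∀ t ∈ F, ∀ a ∈ t, ∃ s ∈ F, t ∩ s = t.erase a
  cover : ∀ v ∈ V, ∃ t ∈ F, v ∈ t
  card_eq : F.card + 4 = 2 * V.card
  four_le : 4 ≤ V.card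

/-- The graph on `V` of the pairs in a common facet is `3`-connected. -/
def LinkConnected (V : Finset α) (F : Finset (Finset α)) : Prop :=
  ∀ S : Finset α, S.card < 3 → ∀ x ∈ V \ S, ∀ y ∈ V \ S,
    Relation.ReflTransGen (fun u w => u ∉ S ∧ w ∉ S ∧ Linked F u w) x y

lemma mem_stackFacets {F : Finset (Finset α)} {t s : Finset α} {v : α} :
    s ∈ stackFacets F t v ↔ (s ≠ t ∧ s ∈ F) ∨ ∃ a ∈ t, insert v (t.erase a) = s := by
  simp [stackFacets, coneFacets]

lemma exists_mem_ne_ne {t : Finset α} (ht : t.card = 3) (u w : α) : ∃ c ∈ t, c ≠ u ∧ c ≠ w := by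
  have h : (({u, w} : Finset α)).card < t.card := by
    have := Finset.card_le_two (a := u) (b := w)
    omega
  obtain ⟨c, hc, hcn⟩ := Finset.exists_mem_notMem_of_card_lt_card h
  simp only [Finset.mem_insert, Finset.mem_singleton, not_or] at hcn
  exact ⟨c, hc, hcn⟩

/-- Only the facet `t` is lost, and each of its edges survives in the cone triangle that omits the
third vertex. -/
lemma Linked.stack {F : Finset (Finset α)} {t : Finset α} {v u w : α} (htc : t.card = 3)
    (h : Linked F u w) : Linked (stackFacets F t v) u w := by
  obtain ⟨s, hs, hu, hw⟩ := h
  by_cases hst : s = t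
  · subst hst
    obtain ⟨c, hc, hcu, hcw⟩ := exists_mem_ne_ne htc u w
    exact ⟨_, mem_stackFacets.2 (Or.inr ⟨c, hc, rfl⟩),
      Finset.mem_insert_of_mem (Finset.mem_erase.2 ⟨hcu.symm, hu⟩),
      Finset.mem_insert_of_mem (Finset.mem_erase.2 ⟨hcw.symm, hw⟩)⟩
  · exact ⟨s, mem_stackFacets.2 (Or.inl ⟨hst, hs⟩), hu, hw⟩

lemma linked_apex {F : Finset (Finset α)} {t : Finset α} {v a : α} (htc : t.card = 3)
    (ha : a ∈ t) : Linked (stackFacets F t v) v a := by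
  obtain ⟨c, hc, hca, -⟩ := exists_mem_ne_ne htc a a
  exact ⟨_, mem_stackFacets.2 (Or.inr ⟨c, hc, rfl⟩), Finset.mem_insert_self _ _,
    Finset.mem_insert_of_mem (Finset.mem_erase.2 ⟨hca.symm, ha⟩)⟩

lemma card_coneFacets {t : Finset α} {v : α} (hv : v ∉ t) : (coneFacets t v).card = t.card := by
  refine Finset.card_image_of_injOn fun a ha b hb h => ?_
  by_contra hab
  have hb' : b ∈ insert v (t.erase b) := by
    have : b ∈ insert v (t.erase a) :=
      Finset.mem_insert_of_mem (Finset.mem_erase.2 ⟨fun h => hab h.symm, hb⟩)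
    simpa only [h] using this
  rcases Finset.mem_insert.1 hb' with h | h
  · exact hv (h ▸ hb)
  · exact Finset.notMem_erase _ _ h

namespace IsTriangulation

variable {V : Finset α} {F : Finset (Finset α)}

lemma facets_nonempty (h : IsTriangulation V F) : F.Nonempty := by
  rw [← Finset.card_pos]
  have := h.card_eq
  have := h.four_le
  omega

lemma ne_of_inter_eq (_ : IsTriangulation V F) {t s : Finset α} {a : α} (ha : a ∈ t)
    (hts : t ∩ s = t.erase a) : s ≠ t := by
  rintro rfl
  rw [Finset.inter_self] at hts
  exact Finset.notMem_erase a s (hts ▸ ha)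

lemma notMem_of_inter_eq (_ : IsTriangulation V F) {t s : Finset α} {a : α} (ha : a ∈ t)
    (hts : t ∩ s = t.erase a) : a ∉ s := fun has =>
  Finset.notMem_erase a t (hts ▸ Finset.mem_inter.2 ⟨ha, has⟩)

lemma stack (h : IsTriangulation V F) {t : Finset α} (ht : t ∈ F) {v : α} (hv : v ∉ V) :
    IsTriangulation (insert v V) (stackFacets F t v) := by
  have hvs : ∀ s ∈ F, v ∉ s := fun s hs hvs => hv (h.subset s hs hvs)
  have htc := h.card_facet t ht
  refine ⟨?_, ?_, ?_, ?_, ?_, ?_⟩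
  · intro s hs
    rcases mem_stackFacets.1 hs with ⟨-, hs⟩ | ⟨a, -, rfl⟩
    · exact (h.subset s hs).trans (Finset.subset_insert _ _)
    · exact Finset.insert_subset_insert _ ((Finset.erase_subset _ _).trans (h.subset t ht))
  · intro s hs
    rcases mem_stackFacets.1 hs with ⟨-, hs⟩ | ⟨a, ha, rfl⟩
    · exact h.card_facet s hs
    · rw [Finset.card_insert_of_notMem fun h => hvs t ht (Finset.mem_of_mem_erase h),
        Finset.card_erase_of_mem ha, htc]
  · intro s hs' c hc
    rcases mem_stackFacets.1 hs' with ⟨hst, hs⟩ | ⟨a, ha, rfl⟩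
    all_goals clear hs'
    · obtain ⟨r, hr, hsr⟩ := h.neighbor s hs c hc
      -- If the neighbour was the deleted facet, its place is taken by the cone triangle over the
      -- common edge, which omits the vertex `d` of `t` outside `s`.
      by_cases hrt : r = t
      · subst hrt
        have hsub : s.erase c ⊆ r := hsr ▸ Finset.inter_subset_right
        have hsc : (s.erase c).card = 2 := by
          rw [Finset.card_erase_of_mem hc, h.card_facet s hs]
        obtain ⟨d, hd, hds⟩ := Finset.exists_mem_notMem_of_card_lt_card
          (show (s.erase c).card < r.card by omega)
        refine ⟨_, mem_stackFacets.2 (Or.inr ⟨d, hd, rfl⟩), ?_⟩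
        ext x
        have hx := Finset.ext_iff.1 hsr x
        have hxv : x = v → x ∉ s := fun hxv => hxv ▸ hvs s hs
        have hxd : x = d → x ∉ s.erase c := fun hxd => hxd ▸ hds
        simp only [Finset.mem_inter, Finset.mem_insert, Finset.mem_erase] at hx hxd ⊢
        tauto
      · exact ⟨r, mem_stackFacets.2 (Or.inl ⟨hrt, hr⟩), hsr⟩
    · rcases Finset.mem_insert.1 hc with rfl | hc
      -- Opposite the apex, the cone triangle meets the old neighbour of `t` across the same edge;
      -- opposite a vertex `c` of `t`, it meets the cone triangle that omits `c`.
      · obtain ⟨r, hr, htr⟩ := h.neighbor t ht a ha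
        refine ⟨r, mem_stackFacets.2 (Or.inl ⟨h.ne_of_inter_eq ha htr, hr⟩), ?_⟩
        ext x
        have hx := Finset.ext_iff.1 htr x
        have hxr : x = c → x ∉ r := fun hxv => hxv ▸ hvs r hr
        have hxt : x = c → x ∉ t := fun hxv => hxv ▸ hvs t ht
        simp only [Finset.mem_inter, Finset.mem_insert, Finset.mem_erase] at hx ⊢
        tauto
      · obtain ⟨hca, hct⟩ := Finset.mem_erase.1 hc
        refine ⟨_, mem_stackFacets.2 (Or.inr ⟨c, hct, rfl⟩), ?_⟩
        ext x
        have hcv : x = v → x ≠ c := fun hx hc => hvs t ht (hx ▸ hc ▸ hct)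
        simp only [Finset.mem_inter, Finset.mem_insert, Finset.mem_erase]
        tauto
  · intro x hx
    rcases Finset.mem_insert.1 hx with rfl | hx
    · obtain ⟨a, ha⟩ := Finset.card_pos.1 (show 0 < t.card by omega)
      exact ⟨_, mem_stackFacets.2 (Or.inr ⟨a, ha, rfl⟩), Finset.mem_insert_self _ _⟩
    · obtain ⟨s, hs, hxs⟩ := h.cover x hx
      obtain ⟨r, hr, hxr, -⟩ := Linked.stack (v := v) htc ⟨s, hs, hxs, hxs⟩
      exact ⟨r, hr, hxr⟩
  · have hd : Disjoint (F.erase t) (coneFacets t v) := by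
      rw [Finset.disjoint_left]
      rintro s hs hs'
      obtain ⟨a, -, rfl⟩ := Finset.mem_image.1 hs'
      exact hvs _ (Finset.mem_of_mem_erase hs) (Finset.mem_insert_self _ _)
    rw [stackFacets, Finset.card_union_of_disjoint hd, card_coneFacets (hvs t ht),
      Finset.card_erase_of_mem ht, Finset.card_insert_of_notMem hv]
    have := h.card_eq
    have := Finset.card_pos.2 ⟨t, ht⟩
    omega
  · rw [Finset.card_insert_of_notMem hv]
    have := h.four_le
    omega

/-- Fewer than three deleted vertices leave some vertex `a` of `t`. It is linked to the apex and, by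
old paths, to every other remaining vertex. -/
lemma linkConnected_stack (h : IsTriangulation V F) (hc : LinkConnected V F) {t : Finset α}
    (ht : t ∈ F) (v : α) : LinkConnected (insert v V) (stackFacets F t v) := by
  have htc := h.card_facet t ht
  intro S hS x hx y hy
  have hold : ∀ x ∈ V \ S, ∀ y ∈ V \ S, Relation.ReflTransGen
      (fun u w => u ∉ S ∧ w ∉ S ∧ Linked (stackFacets F t v) u w) x y := fun x hx y hy =>
    Relation.ReflTransGen.mono (fun u w huw => ⟨huw.1, huw.2.1, huw.2.2.stack htc⟩) _ _
      (hc S hS x hx y hy)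
  obtain ⟨a, hat, haS⟩ := Finset.exists_mem_notMem_of_card_lt_card
    (show S.card < t.card by omega)
  have haV : a ∈ V \ S := Finset.mem_sdiff.2 ⟨h.subset t ht hat, haS⟩
  simp only [Finset.mem_sdiff, Finset.mem_insert] at hx hy
  have toA : ∀ x, (x = v ∨ x ∈ V) ∧ x ∉ S → Relation.ReflTransGen
      (fun u w => u ∉ S ∧ w ∉ S ∧ Linked (stackFacets F t v) u w) x a ∧ Relation.ReflTransGen
      (fun u w => u ∉ S ∧ w ∉ S ∧ Linked (stackFacets F t v) u w) a x := by
    rintro x ⟨rfl | hxV, hxS⟩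
    · exact ⟨.single ⟨hxS, haS, linked_apex htc hat⟩, .single ⟨haS, hxS, (linked_apex htc hat).symm⟩⟩
    · exact ⟨hold x (Finset.mem_sdiff.2 ⟨hxV, hxS⟩) a haV,
        hold a haV x (Finset.mem_sdiff.2 ⟨hxV, hxS⟩)⟩
  exact (toA x hx).1.trans (toA y hy).2

lemma exists_apart (h : IsTriangulation V F) {t : Finset α} (ht : t ∈ F) : ∃ v ∈ V, v ∉ t := by
  have := h.card_facet t ht
  have := h.four_le
  exact Finset.exists_mem_notMem_of_card_lt_card (by omega)

lemma eq_of_subset (h : IsTriangulation V F) {s t : Finset α} (hs : s ∈ F) (ht : t ∈ F)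
    (hst : s ⊆ t) : s = t :=
  Finset.eq_of_subset_of_card_le hst (by rw [h.card_facet s hs, h.card_facet t ht])

end IsTriangulation

/-- The triangles of a tetrahedron form a triangulation. -/
lemma isTriangulation_tetrahedron {V : Finset α} (hV : V.card = 4) :
    IsTriangulation V (V.image V.erase) := by
  have hinj : Set.InjOn V.erase V := fun a ha b _ hab => by
    by_contra hne
    exact Finset.notMem_erase a V (hab ▸ Finset.mem_erase.2 ⟨hne, ha⟩)
  refine ⟨?_, ?_, ?_, ?_, ?_, hV.ge⟩
  · intro t ht
    obtain ⟨a, -, rfl⟩ := Finset.mem_image.1 ht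
    exact Finset.erase_subset _ _
  · intro t ht
    obtain ⟨a, ha, rfl⟩ := Finset.mem_image.1 ht
    rw [Finset.card_erase_of_mem ha, hV]
  · intro t ht b hb
    obtain ⟨a, ha, rfl⟩ := Finset.mem_image.1 ht
    refine ⟨V.erase b, Finset.mem_image_of_mem _ (Finset.mem_of_mem_erase hb), ?_⟩
    ext x
    simp only [Finset.mem_inter, Finset.mem_erase]
    tauto
  · intro v hv
    obtain ⟨a, ha, hav⟩ := Finset.exists_mem_ne (show 1 < V.card by omega) v
    exact ⟨_, Finset.mem_image_of_mem _ ha, Finset.mem_erase.2 ⟨hav.symm, hv⟩⟩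
  · rw [Finset.card_image_of_injOn hinj, hV]

lemma linked_tetrahedron {V : Finset α} (hV : V.card = 4) {u w : α} (hu : u ∈ V) (hw : w ∈ V) :
    Linked (V.image V.erase) u w := by
  have h : (({u, w} : Finset α)).card < V.card := by
    have := Finset.card_le_two (a := u) (b := w)
    omega
  obtain ⟨c, hc, hcn⟩ := Finset.exists_mem_notMem_of_card_lt_card h
  simp only [Finset.mem_insert, Finset.mem_singleton, not_or] at hcn
  exact ⟨_, Finset.mem_image_of_mem _ hc, Finset.mem_erase.2 ⟨Ne.symm hcn.1, hu⟩,
    Finset.mem_erase.2 ⟨Ne.symm hcn.2, hw⟩⟩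

lemma linkConnected_tetrahedron {V : Finset α} (hV : V.card = 4) :
    LinkConnected V (V.image V.erase) := by
  intro S _ x hx y hy
  rw [Finset.mem_sdiff] at hx hy
  exact .single ⟨hx.2, hy.2, linked_tetrahedron hV hx.1 hy.1⟩

end Combinatorics

/-! ### Simplicial polytopes described by functionals. -/

/-- The inequality `l ≤ c` is valid on `V`, with equality exactly on `t`. -/
def FaceFunctional (V t : Finset (Space 3)) (l : Space 3 →L[ℝ] ℝ) (c : ℝ) : Prop :=
  (∀ x ∈ t, l x = c) ∧ ∀ x ∈ V, x ∉ t → l x < c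

/-- `P` is a simplicial `3`-polytope with vertex set `V` and facets the convex hulls of the
members of `F`. -/
structure IsSimplicial (P : Set (Space 3)) (V : Finset (Space 3))
    (F : Finset (Finset (Space 3))) : Prop extends IsTriangulation V F where
  hull : P = convexHull ℝ (V : Set (Space 3))
  span : affineSpan ℝ (V : Set (Space 3)) = ⊤
  functional : ∀ t ∈ F, ∃ l c, FaceFunctional V t l c
  halfSpaces : ∀ x, (∀ t ∈ F, ∃ l c, FaceFunctional V t l c ∧ l x ≤ c) → x ∈ P

/-! ### Convex hulls of finite sets and barycentric coordinates. -/

section General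

variable {E : Type*} [NormedAddCommGroup E] [NormedSpace ℝ E]

lemma le_of_mem_convexHull {V : Set E} {l : E →L[ℝ] ℝ} {c : ℝ} (h : ∀ x ∈ V, l x ≤ c) {x : E}
    (hx : x ∈ convexHull ℝ V) : l x ≤ c :=
  convexHull_min (t := {x | l x ≤ c}) h (convex_halfSpace_le l.toLinearMap.isLinear c) hx

/-- The weighted sum of the nonnegative slacks `c - l x` is zero, so every term vanishes. -/
lemma eq_of_weights {W : Finset E} {l : E →L[ℝ] ℝ} {c : ℝ} (h : ∀ x ∈ W, l x ≤ c) {w : E → ℝ}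
    (hw : ∀ x ∈ W, 0 ≤ w x) (hw1 : ∑ x ∈ W, w x = 1) (hl : l (∑ x ∈ W, w x • x) = c) :
    ∀ x ∈ W, w x ≠ 0 → l x = c := by
  have hsum : ∑ x ∈ W, w x * (c - l x) = 0 := by
    simp only [map_sum, map_smul, smul_eq_mul] at hl
    simp only [mul_sub, Finset.sum_sub_distrib, ← Finset.sum_mul, hw1, hl]
    ring
  intro x hx hwx
  have := (Finset.sum_eq_zero_iff_of_nonneg
    fun x hx => mul_nonneg (hw x hx) (sub_nonneg.2 (h x hx))).1 hsum x hx
  rcases mul_eq_zero.1 this with h0 | h0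
  · exact absurd h0 hwx
  · linarith

lemma mem_convexHull_filter {V : Finset E} {l : E →L[ℝ] ℝ} {c : ℝ} (h : ∀ x ∈ V, l x ≤ c) {x : E}
    (hx : x ∈ convexHull ℝ (V : Set E)) (hl : l x = c) :
    x ∈ convexHull ℝ {y | y ∈ V ∧ l y = c} := by
  obtain ⟨w, hw, hw1, rfl⟩ := Finset.mem_convexHull'.1 hx
  have key := eq_of_weights h hw hw1 hl
  rw [← Finset.sum_filter_of_ne (p := fun x => w x ≠ 0) fun x _ h h0 => h (by simp [h0])]
  refine (convex_convexHull ℝ _).sum_mem (fun y hy => hw y (Finset.mem_filter.1 hy).1) ?_ ?_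
  · rw [← hw1, Finset.sum_filter_of_ne fun x _ h => h]
  · intro y hy
    obtain ⟨hyV, hy0⟩ := Finset.mem_filter.1 hy
    exact subset_convexHull ℝ _ ⟨hyV, key y hyV hy0⟩

/-- A point in the relative interior of the convex hull of a finite set. -/
lemma exists_relint {W : Finset E} (hW : W.Nonempty) : ∃ x ∈ convexHull ℝ (W : Set E),
    ∀ (l : E →L[ℝ] ℝ) (c : ℝ), (∀ y ∈ W, l y ≤ c) → l x = c → ∀ y ∈ W, l y = c := by
  have hc : (0 : ℝ) < W.card := by exact_mod_cast hW.card_pos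
  have h1 : ∑ x ∈ W, (W.card : ℝ)⁻¹ = 1 := by
    rw [Finset.sum_const, nsmul_eq_mul, mul_inv_cancel₀ hc.ne']
  -- The barycentre works because all its weights are nonzero.
  refine ⟨∑ x ∈ W, (W.card : ℝ)⁻¹ • x, (convex_convexHull ℝ _).sum_mem
    (fun _ _ => (inv_pos.2 hc).le) h1 fun y hy => subset_convexHull ℝ _ hy, ?_⟩
  intro l c hl hx y hy
  exact eq_of_weights (w := fun _ => (W.card : ℝ)⁻¹) hl (fun _ _ => (inv_pos.2 hc).le) h1 hx y hy
    (inv_pos.2 hc).ne'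

lemma exists_pos_forall_lt {ι : Type*} (F : Finset ι) {L : ι → E →L[ℝ] ℝ} {C : ι → ℝ} {x : E}
    (h : ∀ t ∈ F, L t x < C t) (y : E) : ∃ ε : ℝ, 0 < ε ∧ ∀ t ∈ F, L t (x + ε • y) < C t := by
  have h1 : ∀ᶠ ε : ℝ in nhds 0, ∀ t ∈ F, L t (x + ε • y) < C t := by
    rw [Filter.eventually_all_finset]
    intro t ht
    have hc : Continuous fun ε : ℝ => L t (x + ε • y) := by fun_prop
    refine hc.continuousAt.eventually_lt continuousAt_const ?_
    simpa using h t ht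
  obtain ⟨ε, h2, h3⟩ := ((h1.filter_mono nhdsWithin_le_nhds).and
    (self_mem_nhdsWithin : Set.Ioi (0 : ℝ) ∈ nhdsWithin 0 (Set.Ioi 0))).exists
  exact ⟨ε, h3, h2⟩

/-- Applying `l - c` to an affine dependence isolates the `i`-th coefficient. -/
lemma affineIndependent_of_functionals {ι : Type*} {p : ι → E}
    (h : ∀ i, ∃ (l : E →L[ℝ] ℝ) (c : ℝ), (∀ j, j ≠ i → l (p j) = c) ∧ l (p i) ≠ c) :
    AffineIndependent ℝ p := by
  rw [affineIndependent_iff]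
  intro s w hw hp i hi
  obtain ⟨l, c, hl, hli⟩ := h i
  have h1 : ∑ j ∈ s, w j * (l (p j) - c) = 0 := by
    have h2 := congrArg l hp
    simp only [map_sum, map_smul, smul_eq_mul, map_zero] at h2
    simp only [mul_sub, Finset.sum_sub_distrib, ← Finset.sum_mul, h2, hw]
    ring
  rw [Finset.sum_eq_single_of_mem i hi fun j _ hj => by rw [hl j hj]; ring] at h1
  exact (mul_eq_zero.1 h1).resolve_right (sub_ne_zero.2 hli)

/-- The points form an affine basis, and the functional opposite `p i` reads off the `i`-th
barycentric coordinate up to a factor. Inequalities for `x` thus become signs of coordinates. -/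
lemma exists_weights [FiniteDimensional ℝ E] {ι : Type*} [Fintype ι]
    (hι : Fintype.card ι = Module.finrank ℝ E + 1) {p : ι → E} {l : ι → E →L[ℝ] ℝ} {c : ι → ℝ}
    (h0 : ∀ i j, j ≠ i → l i (p j) = c i) (h1 : ∀ i, l i (p i) ≠ c i) (x : E) :
    ∃ w : ι → ℝ, ∑ i, w i = 1 ∧ ∑ i, w i • p i = x ∧
      ∀ i, l i x - c i = w i * (l i (p i) - c i) := by
  have hp : AffineIndependent ℝ p :=
    affineIndependent_of_functionals fun i => ⟨l i, c i, h0 i, h1 i⟩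
  let b : AffineBasis ι ℝ E := ⟨p, hp, hp.affineSpan_eq_top_iff_card_eq_finrank_add_one.2 hι⟩
  have hs : ∑ i, b.coord i x = 1 := b.sum_coord_apply_eq_one x
  have hx : ∑ i, b.coord i x • p i = x := b.linear_combination_coord_eq_self x
  refine ⟨fun i => b.coord i x, hs, hx, fun i => ?_⟩
  have h2 : l i x - c i = ∑ j, b.coord j x * (l i (p j) - c i) := by
    conv_lhs => rw [← hx]
    simp only [map_sum, map_smul, smul_eq_mul, mul_sub, Finset.sum_sub_distrib, ← Finset.sum_mul,
      hs]
    ring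
  rw [h2, Finset.sum_eq_single i (fun j _ hj => by rw [h0 i j hj]; ring) (by simp)]

/-- In a hyperplane `f = c`, the simplex with vertices `p i` is cut out by one functional for
each of its facets. -/
lemma mem_convexHull_range_of_functionals [FiniteDimensional ℝ E] {ι : Type*} [Fintype ι]
    (hι : Fintype.card ι = Module.finrank ℝ E) {p : ι → E} {f : E →L[ℝ] ℝ} {c : ℝ} {e : E}
    (hp : ∀ i, f (p i) = c) (he : f e ≠ c) {g : ι → E →L[ℝ] ℝ} {γ : ι → ℝ}
    (h0 : ∀ i j, j ≠ i → g i (p j) = γ i) (h1 : ∀ i, g i (p i) < γ i) {x : E} (hx : f x = c)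
    (hgx : ∀ i, g i x ≤ γ i) : x ∈ convexHull ℝ (Set.range p) := by
  have he' : f e - c ≠ 0 := sub_ne_zero.2 he
  -- Adding `e` as a further vertex makes the simplex full-dimensional. Subtracting the multiple `r
  -- i` of `f` makes `g i` tight at `e` too, and changes no slack on the hyperplane.
  let r : ι → ℝ := fun i => (g i e - γ i) / (f e - c)
  let p' : Option ι → E := fun o => o.elim e p
  let l' : Option ι → E →L[ℝ] ℝ := fun o => o.elim f fun i => g i - r i • f
  let c' : Option ι → ℝ := fun o => o.elim c fun i => γ i - r i * c
  have hr : ∀ i, r i * (f e - c) = g i e - γ i := fun i => div_mul_cancel₀ _ he'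
  have h0' : ∀ i j, j ≠ i → l' i (p' j) = c' i := by
    intro i j hj
    rcases i with _ | i <;> rcases j with _ | j
    · exact absurd rfl hj
    · exact hp j
    · simp only [p', l', c', Option.elim, sub_apply,
        smul_apply, smul_eq_mul]
      linarith [hr i]
    · simp only [p', l', c', Option.elim, sub_apply,
        smul_apply, smul_eq_mul, hp,
        h0 i j fun h => hj (congrArg some h)]
  have h1' : ∀ i, l' i (p' i) ≠ c' i := by
    intro i
    rcases i with _ | i
    · exact he
    · simp only [p', l', c', Option.elim, sub_apply,
        smul_apply, smul_eq_mul, hp]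
      have := h1 i
      intro h
      linarith
  obtain ⟨w, hw1, hwx, hw⟩ := exists_weights (by rw [Fintype.card_option, hι]) h0' h1' x
  have hw0 : w none = 0 := by
    have := hw none
    simp only [p', l', c', Option.elim, hx, sub_self] at this
    exact (mul_eq_zero.1 this.symm).resolve_right he'
  rw [Fintype.sum_option, hw0] at hw1 hwx
  simp only [zero_add, zero_smul, p', Option.elim] at hw1 hwx
  rw [← hwx]
  refine (convex_convexHull ℝ _).sum_mem (fun i _ => ?_) hw1
    fun i _ => subset_convexHull ℝ _ (Set.mem_range_self i)
  have := hw (some i)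
  simp only [p', l', c', Option.elim, sub_apply,
    smul_apply, smul_eq_mul, hx, hp] at this
  have h2 := h1 i
  have h3 := hgx i
  by_contra hneg
  nlinarith [mul_pos (not_le.1 hneg |> neg_pos.2) (sub_pos.2 h2)]

end General

/-! ### Supporting functionals and exposed faces. -/

namespace FaceFunctional

variable {V s t : Finset (Space 3)} {l l' : Space 3 →L[ℝ] ℝ} {c c' : ℝ}

lemma le (h : FaceFunctional V t l c) {x : Space 3} (hx : x ∈ V) : l x ≤ c := by
  by_cases hxt : x ∈ t
  · exact (h.1 x hxt).le
  · exact (h.2 x hx hxt).le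

lemma le_of_mem (h : FaceFunctional V t l c) {x : Space 3}
    (hx : x ∈ convexHull ℝ (V : Set (Space 3))) : l x ≤ c :=
  le_of_mem_convexHull (fun _ hx => h.le hx) hx

lemma mem_iff (h : FaceFunctional V t l c) {x : Space 3} (hx : x ∈ V) : x ∈ t ↔ l x = c :=
  ⟨h.1 x, fun hl => by_contra fun hxt => (h.2 x hx hxt).ne hl⟩

/-- A sum of two valid inequalities is tight only where both are. This produces edges from facets
and vertices from edges. -/
lemma add (h : FaceFunctional V s l c) (h' : FaceFunctional V t l' c') :
    FaceFunctional V (s ∩ t) (l + l') (c + c') := by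
  refine ⟨fun x hx => ?_, fun x hx hxn => ?_⟩
  · rw [Finset.mem_inter] at hx
    simp [h.1 x hx.1, h'.1 x hx.2]
  · rw [Finset.mem_inter, not_and_or] at hxn
    rw [add_apply]
    rcases hxn with hxn | hxn
    · linarith [h.2 x hx hxn, h'.le hx]
    · linarith [h'.2 x hx hxn, h.le hx]

lemma mono {V' : Finset (Space 3)} (h : FaceFunctional V' t l c) (hV : V ⊆ V') :
    FaceFunctional V t l c := ⟨h.1, fun x hx => h.2 x (hV hx)⟩

lemma supports (h : FaceFunctional V t l c) (ht : t ⊆ V) :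
    Supports (convexHull ℝ (V : Set (Space 3))) (convexHull ℝ (t : Set (Space 3))) l c := by
  refine ⟨fun x hx => h.le_of_mem hx, Set.Subset.antisymm (fun x hx => ⟨?_, ?_⟩) ?_⟩
  · exact convexHull_mono (by exact_mod_cast ht) hx
  · refine le_antisymm (le_of_mem_convexHull (fun y hy => (h.1 y hy).le) hx) ?_
    have := le_of_mem_convexHull (l := -l) (c := -c) (fun y hy => by simp [h.1 y hy]) hx
    simpa using this
  · rintro x ⟨hx, hl⟩
    refine convexHull_mono ?_ (mem_convexHull_filter (fun y hy => h.le hy) hx hl)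
    rintro y ⟨hy, hly⟩
    exact (h.mem_iff hy).2 hly

lemma mem_of_mem_convexHull (h : FaceFunctional V t l c) (ht : t ⊆ V) {x : Space 3} (hx : x ∈ V)
    (hxt : x ∈ convexHull ℝ (t : Set (Space 3))) : x ∈ t := by
  rw [(h.supports ht).2] at hxt
  exact (h.mem_iff hx).2 hxt.2

lemma of_supports (h : FaceFunctional V t l' c') (ht : t ⊆ V)
    (hs : Supports (convexHull ℝ (V : Set (Space 3))) (convexHull ℝ (t : Set (Space 3))) l c) :
    FaceFunctional V t l c := by
  have hV : ∀ x ∈ V, x ∈ convexHull ℝ (V : Set (Space 3)) := fun x hx => subset_convexHull ℝ _ hx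
  refine ⟨fun x hx => ?_, fun x hx hxt => lt_of_le_of_ne (hs.1 x (hV x hx)) fun hl => ?_⟩
  · have : x ∈ convexHull ℝ (t : Set (Space 3)) := subset_convexHull ℝ _ hx
    rw [hs.2] at this
    exact this.2
  · refine hxt (h.mem_of_mem_convexHull ht hx ?_)
    rw [hs.2]
    exact ⟨hV x hx, hl⟩

end FaceFunctional

lemma Supports.isExposed {d : ℕ} {P F : Set (Space d)} {l : Space d →L[ℝ] ℝ} {c : ℝ}
    (h : Supports P F l c) : IsExposed ℝ P F := by
  rintro ⟨x₀, hx₀⟩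
  refine ⟨l, Set.Subset.antisymm (fun x hx => ?_) fun x hx => ?_⟩
  · rw [h.2] at hx
    exact ⟨hx.1, fun y hy => hx.2 ▸ h.1 y hy⟩
  · rw [h.2] at hx₀ ⊢
    exact ⟨hx.1, le_antisymm (h.1 x hx.1) (hx₀.2 ▸ hx.2 x₀ hx₀.1)⟩

lemma exists_supports_of_isExposed {d : ℕ} {P F : Set (Space d)} (h : IsExposed ℝ P F)
    (hF : F.Nonempty) : ∃ l c, Supports P F l c := by
  obtain ⟨l, rfl⟩ := h hF
  obtain ⟨x₀, hx₀, hmax⟩ := hF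
  refine ⟨l, l x₀, hmax, Set.Subset.antisymm (fun x hx => ⟨hx.1, ?_⟩) fun x hx => ⟨hx.1, ?_⟩⟩
  · exact le_antisymm (hmax x hx.1) (hx.2 x₀ hx₀)
  · intro y hy
    rw [hx.2]
    exact hmax y hy

/-! ### Faces of simplicial polytopes, and stacking. -/

namespace IsSimplicial

variable {P : Set (Space 3)} {V : Finset (Space 3)} {F : Finset (Finset (Space 3))}

lemma mem_of_vertex (h : IsSimplicial P V F) {v : Space 3} (hv : v ∈ V) : v ∈ P := by
  rw [h.hull]
  exact subset_convexHull ℝ _ hv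

lemma isPolytope (h : IsSimplicial P V F) : IsPolytope P :=
  ⟨⟨V, V.finite_toSet, h.hull⟩, by rw [h.hull, affineSpan_convexHull, h.span]⟩

/-- A point where a nonzero functional attains its maximum lies in a facet. -/
lemma exists_facet_of_max (h : IsSimplicial P V F) {x : Space 3} {l : Space 3 →L[ℝ] ℝ} (hl : l ≠ 0)
    (hx : x ∈ P) (hmax : ∀ y ∈ P, l y ≤ l x) :
    ∃ t ∈ F, ∀ l' c, FaceFunctional V t l' c → l' x = c := by
  by_contra! hne
  choose! L C hLC hne using hne
  have hlt : ∀ t ∈ F, L t x < C t := fun t ht =>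
    lt_of_le_of_ne ((hLC t ht).le_of_mem (h.hull ▸ hx)) (hne t ht)
  refine hl (ContinuousLinearMap.ext fun y => ?_)
  -- All facet inequalities are strict at `x`, so a small step in any direction stays in `P` and
  -- cannot increase `l`.
  have hle : ∀ y, l y ≤ 0 := by
    intro y
    obtain ⟨ε, hε, hy⟩ := exists_pos_forall_lt F hlt y
    have := hmax _ (h.halfSpaces (x + ε • y) fun t ht => ⟨L t, C t, hLC t ht, (hy t ht).le⟩)
    simp only [map_add, map_smul, smul_eq_mul] at this
    nlinarith
  have h2 := hle (-y)
  rw [map_neg] at h2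
  have h3 : l y = 0 := le_antisymm (hle y) (by linarith)
  simpa using h3

/-- The vertices on a supporting plane lie in a common facet. -/
lemma exists_facet_of_le (h : IsSimplicial P V F) {W : Finset (Space 3)} (hW : W ⊆ V)
    (hWn : W.Nonempty) {l : Space 3 →L[ℝ] ℝ} {c : ℝ} (hl : l ≠ 0) (hle : ∀ x ∈ V, l x ≤ c)
    (hWc : ∀ x ∈ W, l x = c) : ∃ t ∈ F, W ⊆ t := by
  -- A facet through a relative interior point of the hull of `W` contains all of `W`.
  obtain ⟨x, hx, hrel⟩ := exists_relint hWn
  have hxV : x ∈ convexHull ℝ (V : Set (Space 3)) := convexHull_mono (by exact_mod_cast hW) hx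
  have hxc : l x = c := by
    refine le_antisymm (le_of_mem_convexHull (fun y hy => (hWc y hy).le) hx) ?_
    have := le_of_mem_convexHull (l := -l) (c := -c) (fun y hy => by simp [hWc y hy]) hx
    simpa using this
  obtain ⟨t, ht, hxt⟩ := h.exists_facet_of_max hl (h.hull ▸ hxV) fun y hy =>
    hxc ▸ le_of_mem_convexHull hle (h.hull ▸ hy)
  obtain ⟨l', c', hl'⟩ := h.functional t ht
  exact ⟨t, ht, fun y hy => (hl'.mem_iff (hW hy)).2
    (hrel l' c' (fun y hy => hl'.le (hW hy)) (hxt l' c' hl') y hy)⟩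

/-- The edge is the intersection of two neighbouring facets; their functionals add up to one for it.
-/
lemma exists_functional_pair (h : IsSimplicial P V F) {u w : Space 3} (huw : u ≠ w)
    (hl : Linked F u w) : ∃ l c, FaceFunctional V {u, w} l c := by
  obtain ⟨t, ht, hu, hw⟩ := hl
  obtain ⟨c, hc, hcu, hcw⟩ := exists_mem_ne_ne (h.card_facet t ht) u w
  obtain ⟨s, hs, hts⟩ := h.neighbor t ht c hc
  obtain ⟨l, γ, hl⟩ := h.functional t ht
  obtain ⟨l', γ', hl'⟩ := h.functional s hs
  have heq : ({u, w} : Finset (Space 3)) = t.erase c := by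
    refine Finset.eq_of_subset_of_card_le ?_ ?_
    · intro x hx
      rcases Finset.mem_insert.1 hx with rfl | hx
      · exact Finset.mem_erase.2 ⟨hcu.symm, hu⟩
      · rw [Finset.mem_singleton] at hx
        exact Finset.mem_erase.2 ⟨hx ▸ hcw.symm, hx ▸ hw⟩
    · rw [Finset.card_erase_of_mem hc, h.card_facet t ht, Finset.card_pair huw]
  exact ⟨_, _, heq ▸ hts ▸ hl.add hl'⟩

lemma exists_functional_singleton (h : IsSimplicial P V F) {v : Space 3} (hv : v ∈ V) :
    ∃ l c, FaceFunctional V {v} l c := by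
  obtain ⟨t, ht, hvt⟩ := h.cover v hv
  obtain ⟨a, hat, hav, -⟩ := exists_mem_ne_ne (h.card_facet t ht) v v
  obtain ⟨b, hbt, hbv, hba⟩ := exists_mem_ne_ne (h.card_facet t ht) v a
  obtain ⟨l, c, hl⟩ := h.exists_functional_pair hav.symm ⟨t, ht, hvt, hat⟩
  obtain ⟨l', c', hl'⟩ := h.exists_functional_pair hbv.symm ⟨t, ht, hvt, hbt⟩
  have heq : ({v} : Finset (Space 3)) = {v, a} ∩ {v, b} := by
    ext x
    have : x = a → x ≠ b := fun h1 h2 => hba (h2.symm.trans h1)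
    simp only [Finset.mem_singleton, Finset.mem_inter, Finset.mem_insert]
    tauto
  exact ⟨_, _, heq ▸ hl.add hl'⟩

lemma isExposed_convexHull (h : IsSimplicial P V F) {s : Finset (Space 3)} (hs : s ⊆ V)
    {l : Space 3 →L[ℝ] ℝ} {c : ℝ} (hl : FaceFunctional V s l c) :
    IsExposed ℝ P (convexHull ℝ (s : Set (Space 3))) := by
  rw [h.hull]
  exact (hl.supports hs).isExposed

lemma isExposed_singleton (h : IsSimplicial P V F) {v : Space 3} (hv : v ∈ V) :
    IsExposed ℝ P {v} := by
  obtain ⟨l, c, hl⟩ := h.exists_functional_singleton hv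
  simpa using h.isExposed_convexHull (Finset.singleton_subset_iff.2 hv) hl

lemma vertices_eq (h : IsSimplicial P V F) : vertices P = V := by
  refine Set.Subset.antisymm ?_ fun v hv => ?_
  · rw [h.hull]
    exact extremePoints_convexHull_subset
  · exact isExtreme_singleton.1 (h.isExposed_singleton hv).isExtreme

lemma pair_subset (h : IsSimplicial P V F) {u w : Space 3} (hl : Linked F u w) :
    ({u, w} : Finset (Space 3)) ⊆ V := by
  obtain ⟨t, ht, hu, hw⟩ := hl
  intro x hx
  rcases Finset.mem_insert.1 hx with rfl | hx
  · exact h.subset t ht hu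
  · exact h.subset t ht (Finset.mem_singleton.1 hx ▸ hw)

lemma exists_eq_convexHull (h : IsSimplicial P V F) {G : Set (Space 3)} (hG : IsExposed ℝ P G)
    (hGn : G.Nonempty) : ∃ (W : Finset (Space 3)) (l : Space 3 →L[ℝ] ℝ) (c : ℝ),
      W ⊆ V ∧ FaceFunctional V W l c ∧ G = convexHull ℝ (W : Set (Space 3)) := by
  classical
  obtain ⟨l, c, hle, hG⟩ := exists_supports_of_isExposed hG hGn
  have hV : ∀ x ∈ V, l x ≤ c := fun x hx => hle x (h.mem_of_vertex hx)
  have hf : FaceFunctional V (V.filter fun x => l x = c) l c := by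
    refine ⟨fun x hx => (Finset.mem_filter.1 hx).2, fun x hx hxn => lt_of_le_of_ne (hV x hx) ?_⟩
    exact fun hlx => hxn (Finset.mem_filter.2 ⟨hx, hlx⟩)
  refine ⟨_, l, c, Finset.filter_subset _ _, hf, ?_⟩
  rw [(hf.supports (Finset.filter_subset _ _)).2, hG, h.hull]

lemma linked_iff (h : IsSimplicial P V F) {u w : Space 3} (huw : u ≠ w) (hu : u ∈ V) (hw : w ∈ V) :
    IsExposed ℝ P (segment ℝ u w) ↔ Linked F u w := by
  rw [← convexHull_pair]
  constructor
  · intro hs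
    obtain ⟨W, l, c, hW, hf, hWe⟩ := h.exists_eq_convexHull hs ⟨u, subset_convexHull ℝ _ (by simp)⟩
    have huW : u ∈ W := hf.mem_of_mem_convexHull hW hu (hWe ▸ subset_convexHull ℝ _ (by simp))
    have hwW : w ∈ W := hf.mem_of_mem_convexHull hW hw (hWe ▸ subset_convexHull ℝ _ (by simp))
    -- For `l = 0` the segment would contain all vertices of `P`; these would be extreme points of a
    -- segment, hence at most two.
    have hl : l ≠ 0 := by
      rintro rfl
      have hV2 : V ⊆ {u, w} := fun x hx => by
        obtain ⟨l', c', hl'⟩ := h.exists_functional_singleton hx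
        by_contra hxn
        simp only [Finset.mem_insert, Finset.mem_singleton, not_or] at hxn
        have hxW : x ∈ W := (hf.mem_iff hx).2 (by simpa using hf.1 u huW)
        have hx2 : x ∈ convexHull ℝ ({u, w} : Set (Space 3)) := hWe ▸ subset_convexHull ℝ _ hxW
        have hx3 : x ∈ (convexHull ℝ ({u, w} : Set (Space 3))).extremePoints ℝ := by
          have : x ∈ P.extremePoints ℝ := by
            have := h.vertices_eq
            rw [vertices] at this
            rw [this]
            exact hx
          exact inter_extremePoints_subset_extremePoints_of_subset hs.subset ⟨hx2, this⟩
        have := extremePoints_convexHull_subset hx3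
        simp only [Set.mem_insert_iff, Set.mem_singleton_iff] at this
        tauto
      have := Finset.card_le_card hV2
      have := Finset.card_le_two (a := u) (b := w)
      have := h.four_le
      omega
    obtain ⟨t, ht, hWt⟩ := h.exists_facet_of_le hW ⟨u, huW⟩ hl (fun x hx => hf.le hx) hf.1
    exact ⟨t, ht, hWt huW, hWt hwW⟩
  · intro hl
    obtain ⟨l, c, hf⟩ := h.exists_functional_pair huw hl
    simpa using h.isExposed_convexHull (h.pair_subset hl) hf

/-- The neighbour of `t` across `a` contains the other two vertices but not `a`, so its functional
certifies affine independence. -/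
lemma finrank_facet (h : IsSimplicial P V F) {t : Finset (Space 3)} (ht : t ∈ F) :
    Module.finrank ℝ (vectorSpan ℝ (convexHull ℝ (t : Set (Space 3)))) = 2 := by
  rw [← direction_affineSpan, affineSpan_convexHull, direction_affineSpan]
  have hi : AffineIndependent ℝ (fun x : t => (x : Space 3)) := by
    refine affineIndependent_of_functionals fun a => ?_
    obtain ⟨s, hs, hts⟩ := h.neighbor t ht a a.2
    obtain ⟨l, c, hl⟩ := h.functional s hs
    refine ⟨l, c, fun b hb => hl.1 b ?_, (hl.2 a (h.subset t ht a.2)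
      (h.notMem_of_inter_eq a.2 hts)).ne⟩
    have : (b : Space 3) ∈ t ∩ s := by
      rw [hts]
      exact Finset.mem_erase.2 ⟨fun h => hb (Subtype.ext h), b.2⟩
    exact (Finset.mem_inter.1 this).2
  have := hi.finrank_vectorSpan (n := 2) (by simp [h.card_facet t ht])
  rwa [show Set.range (fun x : t => (x : Space 3)) = t from Subtype.range_coe] at this

lemma isFacet_iff (h : IsSimplicial P V F) {G : Set (Space 3)} :
    IsFacet P G ↔ ∃ t ∈ F, G = convexHull ℝ (t : Set (Space 3)) := by
  constructor
  · rintro ⟨hG, hGn, hdim⟩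
    obtain ⟨W, l, c, hW, hf, rfl⟩ := h.exists_eq_convexHull hG hGn
    have hWn : W.Nonempty := by
      rw [Finset.nonempty_iff_ne_empty]
      rintro rfl
      simp at hGn
    have hl : l ≠ 0 := by
      rintro rfl
      obtain ⟨x₀, hx₀⟩ := hWn
      have hVW : V ⊆ W := fun x hx => (hf.mem_iff hx).2 (by simpa using hf.1 x₀ hx₀)
      rw [Finset.Subset.antisymm hW hVW, ← direction_affineSpan, affineSpan_convexHull,
        h.span, AffineSubspace.direction_top] at hdim
      simp at hdim
    obtain ⟨t, ht, hWt⟩ := h.exists_facet_of_le hW hWn hl (fun x hx => hf.le hx) hf.1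
    refine ⟨t, ht, ?_⟩
    have htc := h.card_facet t ht
    rw [← direction_affineSpan, affineSpan_convexHull, direction_affineSpan] at hdim
    obtain ⟨n, hn⟩ := Nat.exists_eq_add_of_lt hWn.card_pos
    -- Dimension 2 requires at least three vertices, so `W` is the whole triangle `t`.
    have hle := finrank_vectorSpan_image_finset_le ℝ (id : Space 3 → Space 3) W
      (n := n) (by omega)
    rw [Finset.image_id] at hle
    rw [Finset.eq_of_subset_of_card_le hWt (by omega)]
  · rintro ⟨t, ht, rfl⟩
    obtain ⟨l, c, hl⟩ := h.functional t ht
    obtain ⟨a, ha⟩ := Finset.card_pos.1 (show 0 < t.card by rw [h.card_facet t ht]; norm_num)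
    exact ⟨h.isExposed_convexHull (h.subset t ht) hl, ⟨a, subset_convexHull ℝ _ ha⟩,
      by rw [h.finrank_facet ht]⟩

lemma convexHull_injOn (h : IsSimplicial P V F) {s t : Finset (Space 3)} (hs : s ∈ F) (ht : t ∈ F)
    (hst : convexHull ℝ (s : Set (Space 3)) = convexHull ℝ (t : Set (Space 3))) : s = t := by
  obtain ⟨l, c, hl⟩ := h.functional t ht
  refine h.eq_of_subset hs ht fun x hx => ?_
  exact hl.mem_of_mem_convexHull (h.subset t ht) (h.subset s hs hx)
    (hst ▸ subset_convexHull ℝ _ hx)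

lemma exists_functional_of_supports (h : IsSimplicial P V F) {t : Finset (Space 3)} (ht : t ∈ F)
    {l : Space 3 →L[ℝ] ℝ} {c : ℝ} (hs : Supports P (convexHull ℝ (t : Set (Space 3))) l c) :
    FaceFunctional V t l c := by
  obtain ⟨l', c', hl'⟩ := h.functional t ht
  rw [h.hull] at hs
  exact hl'.of_supports (h.subset t ht) hs

/-- A functional for a facet of the pyramid, as a combination of the functionals of the two
facets of the base polytope through the same edge. -/
lemma exists_functional_cone (h : IsSimplicial P V F) {t : Finset (Space 3)} (ht : t ∈ F)
    {v : Space 3} (hv : ∃ l c, FaceFunctional V t l c ∧ c < l v)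
    (hb : ∀ s ∈ F, s ≠ t → ∃ l c, FaceFunctional V s l c ∧ l v < c) {a : Space 3} (ha : a ∈ t) :
    ∃ l c, FaceFunctional (insert v V) (insert v (t.erase a)) l c := by
  obtain ⟨s, hs, hts⟩ := h.neighbor t ht a ha
  obtain ⟨l₁, c₁, hl₁, hv₁⟩ := hv
  obtain ⟨l₂, c₂, hl₂, hv₂⟩ := hb s hs (h.ne_of_inter_eq ha hts)
  -- Both coefficients are positive, and they are chosen so that the combined inequality is tight at
  -- `v`.
  refine ⟨(c₂ - l₂ v) • l₁ + (l₁ v - c₁) • l₂, (c₂ - l₂ v) * c₁ + (l₁ v - c₁) * c₂, ?_, ?_⟩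
  · intro x hx
    simp only [add_apply, smul_apply, smul_eq_mul]
    rcases Finset.mem_insert.1 hx with rfl | hx
    · ring
    · rw [← hts, Finset.mem_inter] at hx
      rw [hl₁.1 x hx.1, hl₂.1 x hx.2]
  · intro x hx hxn
    simp only [Finset.mem_insert, not_or] at hxn hx
    have hxV := hx.resolve_left hxn.1
    rw [← hts, Finset.mem_inter, not_and_or] at hxn
    simp only [add_apply, smul_apply, smul_eq_mul]
    have e₁ := hl₁.le hxV
    have e₂ := hl₂.le hxV
    rcases hxn.2 with hxt | hxs
    · have := hl₁.2 x hxV hxt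
      nlinarith [mul_pos (sub_pos.2 hv₂) (sub_pos.2 this),
        mul_nonneg (sub_nonneg.2 hv₁.le) (sub_nonneg.2 e₂)]
    · have := hl₂.2 x hxV hxs
      nlinarith [mul_pos (sub_pos.2 hv₁) (sub_pos.2 this),
        mul_nonneg (sub_nonneg.2 hv₂.le) (sub_nonneg.2 e₁)]

lemma notMem_of_beyond {t : Finset (Space 3)} {v : Space 3}
    (hv : ∃ l c, FaceFunctional V t l c ∧ c < l v) : v ∉ V := by
  obtain ⟨l, c, hl, hlv⟩ := hv
  exact fun hvV => (hl.le hvV).not_gt hlv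

/-- The main point is the new half-space description. A point satisfying the new inequalities lies
in `P` if it is not beyond `t`, and otherwise in the simplex spanned by `t` and `v`. -/
lemma stack (h : IsSimplicial P V F) {t : Finset (Space 3)} (ht : t ∈ F)
    {v : Space 3} (hv : ∃ l c, FaceFunctional V t l c ∧ c < l v)
    (hb : ∀ s ∈ F, s ≠ t → ∃ l c, FaceFunctional V s l c ∧ l v < c) :
    IsSimplicial (convexHull ℝ (insert v P)) (insert v V) (stackFacets F t v) := by
  have hvV := notMem_of_beyond hv
  refine ⟨h.toIsTriangulation.stack ht hvV, ?_, ?_, ?_, ?_⟩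
  · rw [h.hull, Finset.coe_insert, Set.insert_eq, Set.insert_eq,
      convexHull_convexHull_union_right]
  · rw [eq_top_iff, ← h.span]
    exact affineSpan_mono ℝ (by simp)
  · intro s hs
    rcases mem_stackFacets.1 hs with ⟨hst, hs⟩ | ⟨a, ha, rfl⟩
    · obtain ⟨l, c, hl, hlv⟩ := hb s hs hst
      refine ⟨l, c, hl.1, fun x hx hxs => ?_⟩
      rcases Finset.mem_insert.1 hx with rfl | hx
      · exact hlv
      · exact hl.2 x hx hxs
    · exact h.exists_functional_cone ht hv hb ha
  · intro x hx
    obtain ⟨l₁, c₁, hl₁, hv₁⟩ := hv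
    by_cases hx₁ : l₁ x ≤ c₁
    · refine subset_convexHull ℝ _ (Set.mem_insert_of_mem _ (h.halfSpaces x fun s hs => ?_))
      by_cases hst : s = t
      · exact ⟨l₁, c₁, hst ▸ hl₁, hx₁⟩
      · obtain ⟨l, c, hl, hlx⟩ := hx s (mem_stackFacets.2 (Or.inl ⟨hst, hs⟩))
        exact ⟨l, c, hl.mono (Finset.subset_insert _ _), hlx⟩
    · have hcone : ∀ a : t, ∃ (l : Space 3 →L[ℝ] ℝ) (c : ℝ),
          FaceFunctional (insert v V) (insert v (t.erase a)) l c ∧ l x ≤ c :=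
        fun a => hx _ (mem_stackFacets.2 (Or.inr ⟨a, a.2, rfl⟩))
      choose L C hLC hLx using hcone
      have hav : ∀ a : t, (a : Space 3) ≠ v := fun a hav =>
        hvV (hav ▸ h.subset t ht a.2)
      have hneg : ∀ a : t, L a a < C a := fun a =>
        (hLC a).2 a (Finset.mem_insert_of_mem (h.subset t ht a.2)) (by simp [hav a])
      -- Barycentric coordinates in that simplex: `l₁` gives the sign of the weight of `v`, the cone
      -- functionals those of the weights of the vertices of `t`.
      obtain ⟨w, hw1, hwx, hw⟩ := exists_weights (ι := Option t)
        (p := fun o => o.elim v fun a => a) (l := fun o => o.elim l₁ L)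
        (c := fun o => o.elim c₁ C) (by simp [h.card_facet t ht])
        (by
          intro i j hj
          rcases i with _ | i <;> rcases j with _ | j
          · exact absurd rfl hj
          · exact hl₁.1 j j.2
          · exact (hLC i).1 v (Finset.mem_insert_self _ _)
          · exact (hLC i).1 j (Finset.mem_insert_of_mem (Finset.mem_erase.2
              ⟨fun h => hj (congrArg some (Subtype.ext h)), j.2⟩)))
        (by
          intro i
          rcases i with _ | i
          · exact hv₁.ne'
          · exact (hneg i).ne)
        x
      rw [← hwx]
      refine (convex_convexHull ℝ _).sum_mem (fun o _ => ?_) hw1 fun o _ => ?_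
      · have := hw o
        rcases o with _ | a
        · simp only [Option.elim] at this
          by_contra hneg'
          nlinarith [mul_pos (neg_pos.2 (not_le.1 hneg')) (sub_pos.2 hv₁)]
        · simp only [Option.elim] at this
          by_contra hneg'
          nlinarith [mul_pos (neg_pos.2 (not_le.1 hneg')) (sub_pos.2 (hneg a)), hLx a]
      · rcases o with _ | a
        · exact subset_convexHull ℝ _ (Set.mem_insert _ _)
        · exact subset_convexHull ℝ _ (Set.mem_insert_of_mem _
            (h.mem_of_vertex (h.subset t ht a.2)))

/-- There is a point beyond a given facet and beneath all the others. -/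
lemma exists_beyond (h : IsSimplicial P V F) {t : Finset (Space 3)} (ht : t ∈ F) :
    ∃ v, (∃ l c, FaceFunctional V t l c ∧ c < l v) ∧
      ∀ s ∈ F, s ≠ t → ∃ l c, FaceFunctional V s l c ∧ l v < c := by
  obtain ⟨l, c, hl⟩ := h.functional t ht
  obtain ⟨d, hd, hdt⟩ := h.exists_apart ht
  have htn : t.Nonempty := Finset.card_pos.1 (by rw [h.card_facet t ht]; norm_num)
  obtain ⟨x, hx, hrel⟩ := exists_relint htn
  choose! L C hLC using h.functional
  have hlt : ∀ s ∈ F.erase t, L s x < C s := by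
    intro s hs
    obtain ⟨hst, hs⟩ := Finset.mem_erase.1 hs
    have hle : ∀ y ∈ t, L s y ≤ C s := fun y hy => (hLC s hs).le (h.subset t ht hy)
    refine lt_of_le_of_ne (le_of_mem_convexHull hle hx) fun heq => hst ?_
    refine (h.eq_of_subset ht hs fun y hy => ?_).symm
    exact ((hLC s hs).mem_iff (h.subset t ht hy)).2 (hrel _ _ hle heq y hy)
  -- A short move from the relative interior of `t`, away from the vertex `d` off `t`, passes beyond
  -- `t` and keeps the other inequalities strict.
  obtain ⟨ε, hε, hy⟩ := exists_pos_forall_lt _ hlt (x - d)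
  have hxc : l x = c := by
    have := hx
    rw [(hl.supports (h.subset t ht)).2] at this
    exact this.2
  refine ⟨x + ε • (x - d), ⟨l, c, hl, ?_⟩, fun s hs hst =>
    ⟨L s, C s, hLC s hs, hy s (Finset.mem_erase.2 ⟨hst, hs⟩)⟩⟩
  have := hl.2 d hd hdt
  simp only [map_add, map_smul, map_sub, smul_eq_mul, hxc]
  nlinarith [mul_pos hε (sub_pos.2 this)]

end IsSimplicial

/-- A tetrahedron is a simplicial polytope. -/
lemma isSimplicial_tetrahedron {p : Fin 4 → Space 3} (hp : AffineIndependent ℝ p) :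
    IsSimplicial (convexHull ℝ (Set.range p)) (Finset.univ.image p)
      ((Finset.univ.image p).image (Finset.univ.image p).erase) := by
  have hcard : (Finset.univ.image p).card = 4 := by
    rw [Finset.card_image_of_injective _ hp.injective]
    simp
  let b : AffineBasis (Fin 4) ℝ (Space 3) :=
    ⟨p, hp, hp.affineSpan_eq_top_iff_card_eq_finrank_add_one.2 (by simp)⟩
  have hb : ∀ i, b i = p i := fun _ => rfl
  have hcoord : ∀ i, ∃ (l : Space 3 →L[ℝ] ℝ) (c : ℝ), ∀ x, c - l x = b.coord i x := by
    intro i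
    refine ⟨-LinearMap.toContinuousLinearMap (b.coord i).linear, b.coord i 0, fun x => ?_⟩
    have := (b.coord i).decomp
    have := congrFun this x
    simp only [Pi.add_apply] at this
    rw [this]
    change _ - -((b.coord i).linear x) = _
    ring
  have hmem : ∀ x, x ∈ Finset.univ.image p ↔ ∃ i, p i = x := by simp
  choose l c hlc using hcoord
  have hface : ∀ i, FaceFunctional (Finset.univ.image p) ((Finset.univ.image p).erase (p i))
      (l i) (c i) := by
    intro i
    constructor
    · intro x hx
      obtain ⟨hxi, hx⟩ := Finset.mem_erase.1 hx
      obtain ⟨j, rfl⟩ := (hmem x).1 hx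
      have h1 := hlc i (p j)
      rw [← hb, b.coord_apply_ne (fun h => hxi (congrArg p h.symm)), hb] at h1
      linarith
    · intro x hx hxn
      have : x = p i := by
        by_contra hne
        exact hxn (Finset.mem_erase.2 ⟨hne, hx⟩)
      subst this
      have h1 := hlc i (p i)
      rw [← hb, b.coord_apply_eq, hb] at h1
      linarith
  have hfunc : ∀ t ∈ (Finset.univ.image p).image (Finset.univ.image p).erase,
      ∃ i, t = (Finset.univ.image p).erase (p i) := by
    intro t ht
    obtain ⟨x, hx, rfl⟩ := Finset.mem_image.1 ht
    obtain ⟨j, rfl⟩ := (hmem x).1 hx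
    exact ⟨j, rfl⟩
  refine ⟨isTriangulation_tetrahedron hcard, by simp, ?_, ?_, ?_⟩
  · rw [Finset.coe_image, Finset.coe_univ, Set.image_univ]
    exact b.tot
  · intro t ht
    obtain ⟨i, rfl⟩ := hfunc t ht
    exact ⟨_, _, hface i⟩
  · intro x hx
    have h1 := b.convexHull_eq_nonneg_coord
    change x ∈ convexHull ℝ (Set.range b)
    rw [h1]
    intro i
    obtain ⟨l', c', hl', hle⟩ := hx _ (Finset.mem_image_of_mem _ ((hmem (p i)).2 ⟨i, rfl⟩))
    -- The slack of any functional for this facet is a positive multiple of the barycentric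
    -- coordinate.
    have h2 : c' - l' x = b.coord i x * (c' - l' (p i)) := by
      have hx1 := b.linear_combination_coord_eq_self x
      have hs := b.sum_coord_apply_eq_one x
      have h3 : c' - l' x = ∑ j, b.coord j x * (c' - l' (p j)) := by
        conv_lhs => rw [← hx1]
        simp only [map_sum, map_smul, smul_eq_mul, mul_sub, Finset.sum_sub_distrib,
          ← Finset.sum_mul, hs, hb]
        ring
      rw [h3, Finset.sum_eq_single i _ (by simp)]
      intro j _ hj
      rw [hl'.1 (p j) (Finset.mem_erase.2
        ⟨fun h => hj (hp.injective h), (hmem (p j)).2 ⟨j, rfl⟩⟩)]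
      ring
    have h4 := hl'.2 (p i) ((hmem (p i)).2 ⟨i, rfl⟩) (Finset.notMem_erase _ _)
    by_contra hneg
    nlinarith [mul_pos (neg_pos.2 (not_le.1 hneg)) (sub_pos.2 h4)]

/-! ### Counting the vertices of slices. -/

/-- The point `z` is a vertex of the slice of `P` by the plane `l = c`, and `s` is the smallest face
of `P` through `z`. -/
structure IsCut (P : Set (Space 3)) (V : Finset (Space 3)) (l : Space 3 →L[ℝ] ℝ) (c : ℝ)
    (s : Finset (Space 3)) (z : Space 3) : Prop where
  mem_vertices : z ∈ vertices ({x | l x = c} ∩ P)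
  mem_convexHull : z ∈ convexHull ℝ (s : Set (Space 3))
  functional : ∃ l c, FaceFunctional V s l c
  subset : ∀ s' l' c', FaceFunctional V s' l' c' → l' z = c' → s ⊆ s'

/-- The smallest face through a point is unique, so slice vertices with different smallest faces are
different. -/
lemma IsCut.eq {P : Set (Space 3)} {V : Finset (Space 3)} {l : Space 3 →L[ℝ] ℝ} {c : ℝ}
    {s s' : Finset (Space 3)} {z : Space 3} (hs : s ⊆ V) (hs' : s' ⊆ V) (h : IsCut P V l c s z)
    (h' : IsCut P V l c s' z) : s = s' := by
  have aux : ∀ {s l' c'}, s ⊆ V → FaceFunctional V s l' c' →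
      z ∈ convexHull ℝ (s : Set (Space 3)) → l' z = c' := by
    intro s l' c' hs hl hz
    rw [(hl.supports hs).2] at hz
    exact hz.2
  obtain ⟨g, γ, hg⟩ := h.functional
  obtain ⟨g', γ', hg'⟩ := h'.functional
  exact Finset.Subset.antisymm (h.subset _ _ _ hg' (aux hs' hg' h'.mem_convexHull))
    (h'.subset _ _ _ hg (aux hs hg h.mem_convexHull))

namespace IsSimplicial

variable {P : Set (Space 3)} {V : Finset (Space 3)} {F : Finset (Finset (Space 3))}
  {l : Space 3 →L[ℝ] ℝ} {c : ℝ}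

lemma convex (h : IsSimplicial P V F) : Convex ℝ P := h.hull ▸ convex_convexHull ℝ _

/-- A slice vertex `x` is determined by the facets through it: if `y` lies in the same facets, the
segment from `y` to `x` can be prolonged beyond `x` inside the slice, which forces `y = x`. -/
lemma slice_finite (h : IsSimplicial P V F) (l : Space 3 →L[ℝ] ℝ) (c : ℝ) :
    (vertices ({x | l x = c} ∩ P)).Finite ∧
      (vertices ({x | l x = c} ∩ P)).ncard ≤ F.powerset.card := by
  classical
  choose! L C hLC using h.functional
  let φ : Space 3 → Finset (Finset (Space 3)) := fun x => F.filter fun t => L t x = C t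
  have hmaps : Set.MapsTo φ (vertices ({x | l x = c} ∩ P)) (F.powerset : Set _) := fun x _ =>
    Finset.mem_coe.2 (Finset.mem_powerset.2 (Finset.filter_subset _ _))
  have hinj : Set.InjOn φ (vertices ({x | l x = c} ∩ P)) := by
    intro x hx y hy hxy
    obtain ⟨⟨hxl, hxP⟩, hxe⟩ := mem_extremePoints.1 hx
    obtain ⟨hyl, hyP⟩ := hy.1
    obtain ⟨ε, hε, hz⟩ := exists_pos_forall_lt (F.filter fun t => L t x < C t) (L := L) (C := C)
      (x := x) (fun t ht => (Finset.mem_filter.1 ht).2) (x - y)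
    have hzP : x + ε • (x - y) ∈ P := by
      refine h.halfSpaces _ fun t ht => ⟨L t, C t, hLC t ht, ?_⟩
      rcases ((hLC t ht).le_of_mem (h.hull ▸ hxP)).lt_or_eq with hlt | heq
      · exact (hz t (Finset.mem_filter.2 ⟨ht, hlt⟩)).le
      · have hty : t ∈ φ y := hxy ▸ Finset.mem_filter.2 ⟨ht, heq⟩
        have := (Finset.mem_filter.1 hty).2
        simp [heq, this]
    have hzl : l (x + ε • (x - y)) = c := by
      change l x = c at hxl
      change l y = c at hyl
      simp [hxl, hyl]
    refine (hxe y ⟨hyl, hyP⟩ _ ⟨hzl, hzP⟩ ⟨ε / (1 + ε), 1 / (1 + ε), by positivity,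
      by positivity, by field_simp; ring, ?_⟩).1.symm
    have h1 : (1 + ε) ≠ 0 := by positivity
    have h2 : ε / (1 + ε) = 1 - 1 / (1 + ε) := by field_simp; ring
    have h3 : (1 / (1 + ε)) * ε = 1 - 1 / (1 + ε) := by field_simp; ring
    rw [smul_add, smul_smul, h3, h2, smul_sub]
    module
  refine ⟨Set.Finite.of_injOn hmaps hinj (Finset.finite_toSet _), ?_⟩
  rw [← Set.ncard_coe_finset]
  exact Set.ncard_le_ncard_of_injOn φ hmaps hinj

/-- A segment in the slice with `z` in its interior stays in the face spanned by `s`, which meets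
the plane only in `z`. -/
lemma mem_vertices_slice (h : IsSimplicial P V F) {s : Finset (Space 3)} (hs : s ⊆ V)
    {g : Space 3 →L[ℝ] ℝ} {γ : ℝ} (hg : FaceFunctional V s g γ) {z : Space 3} (hzl : l z = c)
    (hzs : z ∈ convexHull ℝ (s : Set (Space 3)))
    (huniq : ∀ y ∈ convexHull ℝ (s : Set (Space 3)), l y = c → y = z) :
    z ∈ vertices ({x | l x = c} ∩ P) := by
  have he := (h.isExposed_convexHull hs hg).isExtreme
  refine ⟨⟨hzl, he.subset hzs⟩, ?_⟩
  rintro x ⟨hx, hxP⟩ y ⟨hy, hyP⟩ hxy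
  exact huniq x (he.left_mem_of_mem_openSegment hxP hyP hzs hxy) hx

lemma isCut_singleton (h : IsSimplicial P V F) {v : Space 3} (hv : v ∈ V) (hl : l v = c) :
    IsCut P V l c {v} v := by
  obtain ⟨g, γ, hg⟩ := h.exists_functional_singleton hv
  refine ⟨h.mem_vertices_slice (Finset.singleton_subset_iff.2 hv) hg hl (by simp) ?_, by simp,
    ⟨g, γ, hg⟩, ?_⟩
  · intro y hy _
    simpa using hy
  · intro s' l' c' hl' hv'
    exact Finset.singleton_subset_iff.2 ((hl'.mem_iff hv).2 hv')

lemma exists_isCut_pair (h : IsSimplicial P V F) {u w : Space 3} (huw : Linked F u w)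
    (hu : c < l u) (hw : l w < c) : ∃ z, IsCut P V l c {u, w} z := by
  have hne : u ≠ w := by
    rintro rfl
    exact hu.not_gt hw
  have huV : u ∈ V := h.pair_subset huw (by simp)
  have hwV : w ∈ V := h.pair_subset huw (by simp)
  obtain ⟨g, γ, hg⟩ := h.exists_functional_pair hne huw
  have hd : 0 < l u - l w := by linarith
  have hα : 0 < (c - l w) / (l u - l w) := div_pos (by linarith) hd
  have hβ : 0 < (l u - c) / (l u - l w) := div_pos (by linarith) hd
  have hαβ : (c - l w) / (l u - l w) + (l u - c) / (l u - l w) = 1 := by field_simp; ring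
  -- These weights put `α • u + β • w` on the plane. Both are positive, so every face through this
  -- point contains `u` and `w`.
  set α := (c - l w) / (l u - l w) with hαdef
  set β := (l u - c) / (l u - l w)
  have hαd : α * (l u - l w) = c - l w := div_mul_cancel₀ _ hd.ne'
  have hz : α • u + β • w ∈ convexHull ℝ ((({u, w} : Finset (Space 3))) : Set (Space 3)) := by
    rw [Finset.coe_pair, convexHull_pair]
    exact ⟨α, β, hα.le, hβ.le, hαβ, rfl⟩
  have hβα : β = 1 - α := by linarith
  refine ⟨α • u + β • w, h.mem_vertices_slice (h.pair_subset huw) hg ?_ hz ?_, hz, ⟨g, γ, hg⟩, ?_⟩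
  · simp only [map_add, map_smul, smul_eq_mul, hβα]
    linarith
  · intro y hy hly
    rw [Finset.coe_pair, convexHull_pair] at hy
    obtain ⟨a, b, -, -, hab, rfl⟩ := hy
    have hb : b = 1 - a := by linarith
    subst hb
    simp only [map_add, map_smul, smul_eq_mul] at hly
    have : a = α := by
      rw [hαdef, eq_div_iff hd.ne']
      linarith
    rw [this, hβα]
  · intro s' l' c' hl' hz'
    simp only [map_add, map_smul, smul_eq_mul, hβα] at hz'
    rw [hβα] at hβ
    have e1 := hl'.le huV
    have e2 := hl'.le hwV
    intro x hx
    rcases Finset.mem_insert.1 hx with rfl | hx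
    · refine (hl'.mem_iff huV).2 (le_antisymm e1 ?_)
      by_contra hlt
      nlinarith [mul_pos hα (sub_pos.2 (not_le.1 hlt)), mul_nonneg hβ.le (sub_nonneg.2 e2)]
    · rw [Finset.mem_singleton.1 hx]
      refine (hl'.mem_iff hwV).2 (le_antisymm e2 ?_)
      by_contra hlt
      nlinarith [mul_pos hβ (sub_pos.2 (not_le.1 hlt)), mul_nonneg hα.le (sub_nonneg.2 e1)]

/-- An edge crossed by a plane gives a vertex of the slice, and so does each of the common
neighbours of its ends. -/
lemma card_add_one_le_ncard (h : IsSimplicial P V F) {u w : Space 3} (huw : Linked F u w)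
    (hu : c < l u) (hw : l w < c) {N : Finset (Space 3)}
    (hN : ∀ i ∈ N, Linked F u i ∧ Linked F w i ∧ i ≠ u ∧ i ≠ w) :
    N.card + 1 ≤ (vertices ({x | l x = c} ∩ P)).ncard := by
  obtain ⟨z₀, hz₀⟩ := h.exists_isCut_pair huw hu hw
  -- Depending on the side of `i`, the plane cuts the edge `ui`, the vertex `i` or the edge `iw`.
  -- The face cut contains `i` but no other member of `N`, so the cuts differ.
  have hcut : ∀ i ∈ N, ∃ s z, s ⊆ V ∧ i ∈ s ∧ s ⊆ {i, u, w} ∧ IsCut P V l c s z := by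
    intro i hi
    obtain ⟨hui, hwi, -, -⟩ := hN i hi
    rcases lt_trichotomy (l i) c with hic | hic | hic
    · obtain ⟨z, hz⟩ := h.exists_isCut_pair hui hu hic
      refine ⟨_, z, h.pair_subset hui, by simp, ?_, hz⟩
      intro x
      simp only [Finset.mem_insert, Finset.mem_singleton]
      tauto
    · have hiV : i ∈ V := h.pair_subset hui (by simp)
      exact ⟨_, i, Finset.singleton_subset_iff.2 hiV, by simp, by simp, h.isCut_singleton hiV hic⟩
    · obtain ⟨z, hz⟩ := h.exists_isCut_pair hwi.symm hic hw
      refine ⟨_, z, h.pair_subset hwi.symm, by simp, ?_, hz⟩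
      intro x
      simp only [Finset.mem_insert, Finset.mem_singleton]
      tauto
  choose! s z hsV his hsub hz using hcut
  have hinj : Set.InjOn z N := by
    intro i hi j hj hij
    have heq := IsCut.eq (hsV i hi) (hsV j hj) (hz i hi) (hij ▸ hz j hj)
    have := hsub j hj (heq ▸ his i hi)
    simp only [Finset.mem_insert, Finset.mem_singleton] at this
    have := hN i hi
    tauto
  have hz₀N : z₀ ∉ N.image z := by
    intro hmem
    obtain ⟨i, hi, hzi⟩ := Finset.mem_image.1 hmem
    have heq := IsCut.eq (hsV i hi) (h.pair_subset huw) (hz i hi) (hzi ▸ hz₀)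
    have := heq ▸ his i hi
    simp only [Finset.mem_insert, Finset.mem_singleton] at this
    have := hN i hi
    tauto
  rw [← Finset.card_image_of_injOn hinj, ← Finset.card_insert_of_notMem hz₀N,
    ← Set.ncard_coe_finset]
  refine Set.ncard_le_ncard ?_ (h.slice_finite l c).1
  intro y hy
  rcases Finset.mem_insert.1 (Finset.mem_coe.1 hy) with rfl | hy
  · exact hz₀.mem_vertices
  · obtain ⟨i, hi, rfl⟩ := Finset.mem_image.1 hy
    exact (hz i hi).mem_vertices

lemma ncard_le_of_subset_convexHull (h : IsSimplicial P V F) {ι : Type*} [Fintype ι]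
    {p : ι → Space 3} (hp : ∀ i, l (p i) = c ∧ p i ∈ P)
    (hsub : ∀ x, l x = c → x ∈ P → x ∈ convexHull ℝ (Set.range p)) :
    (vertices ({x | l x = c} ∩ P)).ncard ≤ Fintype.card ι := by
  have heq : {x | l x = c} ∩ P = convexHull ℝ (Set.range p) := by
    refine Set.Subset.antisymm (fun x hx => hsub x hx.1 hx.2) (convexHull_min ?_ ?_)
    · rintro _ ⟨i, rfl⟩
      exact hp i
    · exact (convex_hyperplane l.toLinearMap.isLinear c).inter h.convex
  rw [heq, vertices, ← Nat.card_eq_fintype_card, ← Set.ncard_univ]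
  refine (Set.ncard_le_ncard extremePoints_convexHull_subset (Set.finite_range p)).trans ?_
  rw [← Set.image_univ]
  exact Set.ncard_image_le

/-- The triangle `t` need not be a facet. Its sides are edges of `P`, and their supporting
functionals confine the slice to the triangle. -/
lemma ncard_le_three_of_triangle (h : IsSimplicial P V F) {t : Finset (Space 3)} (htc : t.card = 3)
    (hlink : ∀ a ∈ t, ∀ b ∈ t, Linked F a b) (htl : ∀ a ∈ t, l a = c) {e : Space 3}
    (he : l e ≠ c) : (vertices ({x | l x = c} ∩ P)).ncard ≤ 3 := by
  have htV : ∀ a ∈ t, a ∈ V := fun a ha => h.pair_subset (hlink a ha a ha) (by simp)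
  have hg : ∀ a : t, ∃ l c, FaceFunctional V (t.erase a) l c := by
    intro a
    obtain ⟨b, d, hbd, heq⟩ := Finset.card_eq_two.1
      (show (t.erase (a : Space 3)).card = 2 by rw [Finset.card_erase_of_mem a.2, htc])
    have hb : b ∈ t.erase (a : Space 3) := by simp [heq]
    have hd : d ∈ t.erase (a : Space 3) := by simp [heq]
    rw [heq]
    exact h.exists_functional_pair hbd
      (hlink b (Finset.mem_of_mem_erase hb) d (Finset.mem_of_mem_erase hd))
  choose g γ hg using hg
  have := h.ncard_le_of_subset_convexHull (ι := t) (p := fun a => a) (l := l) (c := c)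
    (fun a => ⟨htl a a.2, h.mem_of_vertex (htV a a.2)⟩) fun x hx hxP =>
      mem_convexHull_range_of_functionals (p := fun a : t => (a : Space 3)) (by simp [htc])
        (fun a => htl a a.2) he (g := g) (γ := γ)
        (fun a b hb => (hg a).1 b (Finset.mem_erase.2 ⟨fun h => hb (Subtype.ext h), b.2⟩))
        (fun a => (hg a).2 a (htV a a.2) (Finset.notMem_erase _ _)) hx
        fun a => (hg a).le_of_mem (h.hull ▸ hxP)
  simpa [htc] using this

/-- The three facets at `v` confine the slice to the triangle whose corners are the points where the
edges from `v` meet the plane. -/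
lemma ncard_le_three_of_apex_lt (h : IsSimplicial P V F) {t : Finset (Space 3)} (htc : t.card = 3)
    (htV : t ⊆ V) {v : Space 3} (hvt : v ∉ t) (hF : coneFacets t v ⊆ F) (hv : l v < c)
    (ht : ∀ a ∈ t, c ≤ l a) : (vertices ({x | l x = c} ∩ P)).ncard ≤ 3 := by
  have hmem : ∀ a : t, insert v (t.erase (a : Space 3)) ∈ F := fun a =>
    hF (Finset.mem_image_of_mem _ a.2)
  have hg : ∀ a : t, ∃ l c, FaceFunctional V (insert v (t.erase (a : Space 3))) l c := fun a =>
    h.functional _ (hmem a)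
  choose g γ hg using hg
  have hvV : v ∈ V := by
    obtain ⟨a, ha⟩ := Finset.card_pos.1 (show 0 < t.card by omega)
    exact h.subset _ (hmem ⟨a, ha⟩) (Finset.mem_insert_self _ _)
  have hd : ∀ a : t, 0 < l a - l v := fun a => by linarith [ht a a.2]
  let r : t → ℝ := fun a => (c - l v) / (l a - l v)
  have hr : ∀ a, r a * (l a - l v) = c - l v := fun a => div_mul_cancel₀ _ (hd a).ne'
  have hr0 : ∀ a, 0 < r a := fun a => div_pos (by linarith) (hd a)
  have hr1 : ∀ a, r a ≤ 1 := fun a => (div_le_one (hd a)).2 (by linarith [ht a a.2])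
  have hgv : ∀ a, g a v = γ a := fun a => (hg a).1 v (Finset.mem_insert_self _ _)
  have hpl : ∀ a : t, l (v + r a • ((a : Space 3) - v)) = c := fun a => by
    simp only [map_add, map_smul, map_sub, smul_eq_mul, hr]
    ring
  have := h.ncard_le_of_subset_convexHull (ι := t) (p := fun a => v + r a • ((a : Space 3) - v))
    (l := l) (c := c) (fun a => ⟨hpl a, ?_⟩) fun x hx hxP =>
      mem_convexHull_range_of_functionals (by simp [htc]) hpl hv.ne (g := g) (γ := γ) ?_ ?_ hx
        fun a => (hg a).le_of_mem (h.hull ▸ hxP)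
  · simpa [htc] using this
  · exact h.convex.add_smul_sub_mem (h.mem_of_vertex hvV) (h.mem_of_vertex (htV a.2))
      ⟨(hr0 a).le, hr1 a⟩
  · intro a b hb
    have : g a b = γ a := (hg a).1 b (Finset.mem_insert_of_mem (Finset.mem_erase.2
      ⟨fun h => hb (Subtype.ext h), b.2⟩))
    simp only [map_add, map_smul, map_sub, smul_eq_mul, this, hgv]
    ring
  · intro a
    have hlt : g a a < γ a := (hg a).2 a (htV a.2) fun hmem => by
      rcases Finset.mem_insert.1 hmem with h | h
      · exact hvt (h ▸ a.2)
      · exact Finset.notMem_erase _ _ h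
    simp only [map_add, map_smul, map_sub, smul_eq_mul, hgv]
    nlinarith [mul_pos (hr0 a) (sub_pos.2 hlt)]

/-- The slice is a face, whose vertices lie in a common triangle. -/
lemma ncard_le_three_of_le (h : IsSimplicial P V F) (hl : l ≠ 0) (hV : ∀ x ∈ V, l x ≤ c) :
    (vertices ({x | l x = c} ∩ P)).ncard ≤ 3 := by
  classical
  have hsub : vertices ({x | l x = c} ∩ P) ⊆ (V.filter fun x => l x = c : Finset (Space 3)) := by
    have heq : {x | l x = c} ∩ P = convexHull ℝ {y | y ∈ V ∧ l y = c} := by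
      refine Set.Subset.antisymm (fun x hx => mem_convexHull_filter hV (h.hull ▸ hx.2) hx.1)
        (convexHull_min (fun y hy => ⟨hy.2, h.mem_of_vertex hy.1⟩) ?_)
      exact (convex_hyperplane l.toLinearMap.isLinear c).inter h.convex
    rw [heq, Finset.coe_filter]
    exact extremePoints_convexHull_subset
  refine (Set.ncard_le_ncard hsub (Finset.finite_toSet _)).trans ?_
  rw [Set.ncard_coe_finset]
  rcases (V.filter fun x => l x = c).eq_empty_or_nonempty with he | hne
  · simp [he]
  · obtain ⟨t, ht, hsub⟩ := h.exists_facet_of_le (Finset.filter_subset _ _) hne hl hV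
      fun x hx => (Finset.mem_filter.1 hx).2
    exact (Finset.card_le_card hsub).trans (h.card_facet t ht).le

end IsSimplicial

/-- Bookkeeping for the facets left after stacking on `t` and then along `D`: cone triangles over
`t` do not occur in `D`. -/
lemma or_and_not_or_iff {p q r d x : Prop} (h : r → ¬d) :
    ((¬p ∧ q) ∨ r) ∧ ¬d ∨ x ↔ (q ∧ ¬(p ∨ d)) ∨ r ∨ x := by
  tauto

section Combinatorics

variable {α : Type*}

lemma Linked.mono {F F' : Finset (Finset α)} {u w : α} (h : Linked F u w) (hF : F ⊆ F') :
    Linked F' u w := by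
  obtain ⟨t, ht, hu, hw⟩ := h
  exact ⟨t, hF ht, hu, hw⟩

variable [DecidableEq α]

lemma linked_coneFacets_apex {t : Finset α} {v a : α} (htc : t.card = 3) (ha : a ∈ t) :
    Linked (coneFacets t v) v a := by
  obtain ⟨c, hc, hca, -⟩ := exists_mem_ne_ne htc a a
  exact ⟨_, Finset.mem_image_of_mem _ hc, Finset.mem_insert_self _ _,
    Finset.mem_insert_of_mem (Finset.mem_erase.2 ⟨hca.symm, ha⟩)⟩

lemma linked_coneFacets {t : Finset α} {v a b : α} (htc : t.card = 3) (ha : a ∈ t) (hb : b ∈ t) :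
    Linked (coneFacets t v) a b := by
  obtain ⟨c, hc, hca, hcb⟩ := exists_mem_ne_ne htc a b
  exact ⟨_, Finset.mem_image_of_mem _ hc,
    Finset.mem_insert_of_mem (Finset.mem_erase.2 ⟨hca.symm, ha⟩),
    Finset.mem_insert_of_mem (Finset.mem_erase.2 ⟨hcb.symm, hb⟩)⟩

end Combinatorics

/-! ### Planes that separate vertices. -/

/-- Every plane that strictly separates two vertices crosses an edge, or it contains three pairwise
adjacent vertices. -/
def CrossesEdgeOrTriangle (V : Finset (Space 3)) (F : Finset (Finset (Space 3))) : Prop :=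
  ∀ (l : Space 3 →L[ℝ] ℝ) (c : ℝ), (∃ u ∈ V, c < l u) → (∃ w ∈ V, l w < c) →
    (∃ u w, Linked F u w ∧ c < l u ∧ l w < c) ∨
      ∃ t : Finset (Space 3), t.card = 3 ∧ (∀ a ∈ t, l a = c) ∧ ∀ a ∈ t, ∀ b ∈ t, Linked F a b

/-- The only new case is `v` alone strictly on one side. Then some vertex of `t` is strictly on the
other side, and its edge to `v` is crossed, or all of `t` lies in the plane. -/
lemma IsTriangulation.crossesEdgeOrTriangle_stack {V : Finset (Space 3)}
    {F : Finset (Finset (Space 3))} (h : IsTriangulation V F) (hc : CrossesEdgeOrTriangle V F)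
    {t : Finset (Space 3)} (ht : t ∈ F) (v : Space 3) :
    CrossesEdgeOrTriangle (insert v V) (stackFacets F t v) := by
  have htc := h.card_facet t ht
  rintro l c ⟨u, hu, hlu⟩ ⟨w, hw, hlw⟩
  by_cases hpos : ∃ u ∈ V, c < l u
  · by_cases hneg : ∃ w ∈ V, l w < c
    · rcases hc l c hpos hneg with ⟨u, w, huw, h⟩ | ⟨s, hs, hsl, hlink⟩
      · exact Or.inl ⟨u, w, huw.stack htc, h⟩
      · exact Or.inr ⟨s, hs, hsl, fun a ha b hb => (hlink a ha b hb).stack htc⟩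
    · push Not at hneg
      have hwv : w = v := (Finset.mem_insert.1 hw).resolve_right fun h => (hneg w h).not_gt hlw
      subst hwv
      by_cases hta : ∃ a ∈ t, c < l a
      · obtain ⟨a, ha, hla⟩ := hta
        exact Or.inl ⟨a, w, (linked_apex htc ha).symm, hla, hlw⟩
      · push Not at hta
        exact Or.inr ⟨t, htc, fun a ha => le_antisymm (hta a ha) (hneg a (h.subset t ht ha)),
          fun a ha b hb => Linked.stack htc ⟨t, ht, ha, hb⟩⟩
  · push Not at hpos
    have huv : u = v := (Finset.mem_insert.1 hu).resolve_right fun h => (hpos u h).not_gt hlu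
    subst huv
    by_cases hta : ∃ a ∈ t, l a < c
    · obtain ⟨a, ha, hla⟩ := hta
      exact Or.inl ⟨u, a, linked_apex htc ha, hlu, hla⟩
    · push Not at hta
      exact Or.inr ⟨t, htc, fun a ha => le_antisymm (hpos a (h.subset t ht ha)) (hta a ha),
        fun a ha b hb => Linked.stack htc ⟨t, ht, ha, hb⟩⟩

/-- The properties shared by all the polytopes that arise from a tetrahedron by stacking. -/
structure IsStacked (P : Set (Space 3)) (V : Finset (Space 3))
    (F : Finset (Finset (Space 3))) : Prop extends IsSimplicial P V F where
  linkConnected : LinkConnected V F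
  crosses : CrossesEdgeOrTriangle V F

lemma isStacked_tetrahedron {p : Fin 4 → Space 3} (hp : AffineIndependent ℝ p) :
    IsStacked (convexHull ℝ (Set.range p)) (Finset.univ.image p)
      ((Finset.univ.image p).image (Finset.univ.image p).erase) := by
  have hcard : (Finset.univ.image p).card = 4 := by
    rw [Finset.card_image_of_injective _ hp.injective]
    simp
  refine ⟨isSimplicial_tetrahedron hp, linkConnected_tetrahedron hcard, ?_⟩
  rintro l c ⟨u, hu, hlu⟩ ⟨w, hw, hlw⟩
  exact Or.inl ⟨u, w, linked_tetrahedron hcard hu hw, hlu, hlw⟩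

/-! ### Stacking on all facets. -/

namespace IsStacked

variable {P Q : Set (Space 3)} {V : Finset (Space 3)} {F : Finset (Finset (Space 3))}

lemma stack (h : IsStacked P V F) {t : Finset (Space 3)} (ht : t ∈ F)
    {v : Space 3} (hv : ∃ l c, FaceFunctional V t l c ∧ c < l v)
    (hb : ∀ s ∈ F, s ≠ t → ∃ l c, FaceFunctional V s l c ∧ l v < c) :
    IsStacked (convexHull ℝ (insert v P)) (insert v V) (stackFacets F t v) :=
  ⟨h.toIsSimplicial.stack ht hv hb, h.linkConnected_stack h.linkConnected ht v,
    h.crossesEdgeOrTriangle_stack h.crosses ht v⟩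

/-- The result of stacking along a list of facets. -/
lemma of_isStackingAlong (D : List (Finset (Space 3))) : ∀ {P Q : Set (Space 3)}
    {V : Finset (Space 3)} {F : Finset (Finset (Space 3))}, IsStacked P V F → D.Nodup →
    (∀ t ∈ D, t ∈ F) →
    IsStackingAlong (D.map fun t : Finset (Space 3) => convexHull ℝ (t : Set (Space 3))) P Q →
    ∃ (V' : Finset (Space 3)) (F' : Finset (Finset (Space 3))) (apex : Finset (Space 3) → Space 3),
      IsStacked Q V' F' ∧ (∀ x, x ∈ V' ↔ x ∈ V ∨ ∃ t ∈ D, apex t = x) ∧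
      (∀ s, s ∈ F' ↔ (s ∈ F ∧ s ∉ D) ∨ ∃ t ∈ D, s ∈ coneFacets t (apex t)) ∧
      (∀ s ∈ D, ∀ t ∈ D, apex s = apex t → s = t) ∧ (∀ t ∈ D, apex t ∉ V) ∧
      V'.card = V.card + D.length := by
  induction D with
  | nil =>
    intro P Q V F h _ _ hQ
    obtain rfl : Q = P := hQ
    exact ⟨V, F, fun _ => 0, h, by simp, by simp, by simp, by simp, by simp⟩
  | cons t D ih =>
    intro P Q V F h hD hDF hQ
    obtain ⟨htD, hD⟩ := List.nodup_cons.1 hD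
    have ht : t ∈ F := hDF t List.mem_cons_self
    have hDF' : ∀ s ∈ D, s ∈ F := fun s hs => hDF s (List.mem_cons_of_mem _ hs)
    obtain ⟨-, v, ⟨l, c, hl, hlv⟩, hbeneath, hQ⟩ := hQ
    have hv : ∃ l c, FaceFunctional V t l c ∧ c < l v :=
      ⟨l, c, h.exists_functional_of_supports ht hl, hlv⟩
    have hvV : v ∉ V := IsSimplicial.notMem_of_beyond hv
    have hst := h.stack ht hv fun s hs hst => by
      obtain ⟨l, c, hl, hlv⟩ := hbeneath _ (h.isFacet_iff.2 ⟨s, hs, rfl⟩)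
        fun heq => hst (h.convexHull_injOn hs ht heq)
      exact ⟨l, c, h.exists_functional_of_supports hs hl, hlv⟩
    obtain ⟨V', F', apex, hQs, hV', hF', hinj, hnot, hcard⟩ := ih hst hD (fun s hs =>
      mem_stackFacets.2 (Or.inl ⟨fun heq => htD (heq ▸ hs), hDF' s hs⟩)) hQ
    have hup : ∀ s ∈ D, Function.update apex t v s = apex s := fun s hs =>
      Function.update_of_ne (fun heq : s = t => htD (heq ▸ hs)) _ _
    -- New triangles contain `v`, which is not in `V`, so none of them is stacked later in the
    -- round.
    have hcv : ∀ s ∈ coneFacets t v, s ∉ D := by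
      intro s hs hsD
      obtain ⟨a, -, rfl⟩ := Finset.mem_image.1 hs
      exact hvV (h.subset _ (hDF' _ hsD) (Finset.mem_insert_self _ _))
    refine ⟨V', F', Function.update apex t v, hQs, ?_, ?_, ?_, ?_, ?_⟩
    · intro x
      rw [hV', Finset.mem_insert, List.exists_mem_cons_iff, Function.update_self]
      have : (∃ s ∈ D, Function.update apex t v s = x) ↔ ∃ s ∈ D, apex s = x :=
        exists_congr fun s => and_congr_right fun hs => by rw [hup s hs]
      rw [this, eq_comm (a := v), or_left_comm, or_assoc]
    · intro s
      rw [hF', List.exists_mem_cons_iff, Function.update_self]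
      have : (∃ r ∈ D, s ∈ coneFacets r (Function.update apex t v r)) ↔
          ∃ r ∈ D, s ∈ coneFacets r (apex r) :=
        exists_congr fun s => and_congr_right fun hs => by rw [hup s hs]
      rw [this, stackFacets, Finset.mem_union, Finset.mem_erase, List.mem_cons]
      exact or_and_not_or_iff (hcv s)
    · intro r hr' s hs' heq
      rcases List.mem_cons.1 hr' with rfl | hr <;> rcases List.mem_cons.1 hs' with rfl | hs
      · rfl
      · rw [Function.update_self, hup s hs] at heq
        exact absurd (Finset.mem_insert.2 (Or.inl heq.symm)) (hnot s hs)
      · rw [Function.update_self, hup r hr] at heq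
        exact absurd (Finset.mem_insert.2 (Or.inl heq)) (hnot r hr)
      · rw [hup r hr, hup s hs] at heq
        exact hinj r hr s hs heq
    · intro s hs
      rcases List.mem_cons.1 hs with rfl | hs
      · rwa [Function.update_self]
      · rw [hup s hs]
        exact fun hsV => hnot s hs (Finset.mem_insert_of_mem hsV)
    · rw [hcard, Finset.card_insert_of_notMem hvV, List.length_cons]
      ring

lemma exists_isStackingAlong (D : List (Finset (Space 3))) : ∀ {P : Set (Space 3)}
    {V : Finset (Space 3)} {F : Finset (Finset (Space 3))}, IsStacked P V F → D.Nodup →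
    (∀ t ∈ D, t ∈ F) →
    ∃ Q, IsStackingAlong (D.map fun t : Finset (Space 3) => convexHull ℝ (t : Set (Space 3))) P Q := by
  induction D with
  | nil => exact fun _ _ _ => ⟨_, rfl⟩
  | cons t D ih =>
    intro P V F h hD hDF
    obtain ⟨htD, hD⟩ := List.nodup_cons.1 hD
    have ht : t ∈ F := hDF t List.mem_cons_self
    obtain ⟨v, hv, hb⟩ := h.exists_beyond ht
    obtain ⟨Q, hQ⟩ := ih (h.stack ht hv hb) hD fun s hs =>
      mem_stackFacets.2 (Or.inl ⟨fun heq => htD (heq ▸ hs), hDF s (List.mem_cons_of_mem _ hs)⟩)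
    refine ⟨Q, h.isFacet_iff.2 ⟨t, ht, rfl⟩, v, ?_, ?_, hQ⟩
    · obtain ⟨l, c, hl, hlv⟩ := hv
      exact ⟨l, c, h.hull ▸ hl.supports (h.subset t ht), hlv⟩
    · intro G hG hGt
      obtain ⟨s, hs, rfl⟩ := h.isFacet_iff.1 hG
      obtain ⟨l, c, hl, hlv⟩ := hb s hs fun heq => hGt (heq ▸ rfl)
      exact ⟨l, c, h.hull ▸ hl.supports (h.subset s hs), hlv⟩

lemma exists_isAllFacetsStacking (h : IsStacked P V F) : ∃ Q, IsAllFacetsStacking P Q := by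
  obtain ⟨Q, hQ⟩ := exists_isStackingAlong F.toList h F.nodup_toList fun t ht =>
    Finset.mem_toList.1 ht
  refine ⟨Q, _, ?_, ?_, hQ⟩
  · exact List.Nodup.map_on (fun s hs t ht => h.convexHull_injOn (Finset.mem_toList.1 hs)
      (Finset.mem_toList.1 ht)) F.nodup_toList
  · intro G
    rw [h.isFacet_iff, List.mem_map]
    simp only [Finset.mem_toList, eq_comm]

/-- The result of stacking on all facets of a polytope. -/
lemma of_isAllFacetsStacking (h : IsStacked P V F) (hQ : IsAllFacetsStacking P Q) :
    ∃ (V' : Finset (Space 3)) (F' : Finset (Finset (Space 3))) (apex : Finset (Space 3) → Space 3),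
      IsStacked Q V' F' ∧ (∀ x, x ∈ V' ↔ x ∈ V ∨ ∃ t ∈ F, apex t = x) ∧
      (∀ s, s ∈ F' ↔ ∃ t ∈ F, s ∈ coneFacets t (apex t)) ∧
      (∀ s ∈ F, ∀ t ∈ F, apex s = apex t → s = t) ∧ (∀ t ∈ F, apex t ∉ V) ∧
      V'.card = V.card + F.card := by
  classical
  obtain ⟨L, hL, hLF, hLQ⟩ := hQ
  -- Recovers the vertex triangle from a geometric facet, translating the list of facets into a list
  -- of members of `F`.
  let g : Set (Space 3) → Finset (Space 3) := fun G => V.filter fun x => x ∈ G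
  have hg : ∀ t ∈ F, g (convexHull ℝ (t : Set (Space 3))) = t := by
    intro t ht
    obtain ⟨l, c, hl⟩ := h.functional t ht
    ext x
    rw [Finset.mem_filter]
    exact ⟨fun hx => hl.mem_of_mem_convexHull (h.subset t ht) hx.1 hx.2,
      fun hx => ⟨h.subset t ht hx, subset_convexHull ℝ _ hx⟩⟩
  have hgL : ∀ G ∈ L, g G ∈ F ∧ convexHull ℝ (g G : Set (Space 3)) = G := by
    intro G hG
    obtain ⟨t, ht, rfl⟩ := h.isFacet_iff.1 ((hLF G).1 hG)
    rw [hg t ht]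
    exact ⟨ht, rfl⟩
  have hmap : ((L.map g).map fun t : Finset (Space 3) => convexHull ℝ (t : Set (Space 3))) = L := by
    rw [List.map_map]
    exact (List.map_congr_left fun G hG => (hgL G hG).2).trans (List.map_id' L)
  have hnd : (L.map g).Nodup := List.Nodup.map_on
    (fun G hG G' hG' heq => by rw [← (hgL G hG).2, ← (hgL G' hG').2, heq]) hL
  have hmem : ∀ t, t ∈ L.map g ↔ t ∈ F := by
    intro t
    rw [List.mem_map]
    constructor
    · rintro ⟨G, hG, rfl⟩
      exact (hgL G hG).1
    · exact fun ht => ⟨_, (hLF _).2 (h.isFacet_iff.2 ⟨t, ht, rfl⟩), hg t ht⟩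
  obtain ⟨V', F', apex, h1, h2, h3, h4, h5, h6⟩ := of_isStackingAlong (L.map g) h hnd
    (fun t ht => (hmem t).1 ht) (by rw [hmap]; exact hLQ)
  simp only [hmem] at h2 h3 h4 h5
  refine ⟨V', F', apex, h1, h2, fun s => ?_, h4, h5, ?_⟩
  · rw [h3]
    tauto
  · rw [h6, ← List.toFinset_card_of_nodup hnd]
    congr 2
    ext t
    rw [List.mem_toFinset, hmem]

end IsStacked

/-! ### Face lattice and graph of a simplicial polytope. -/

instance {d : ℕ} (P : Set (Space d)) : OrderBot (faces P) where
  bot := ⟨∅, fun h => absurd h Set.not_nonempty_empty⟩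
  bot_le X := Set.empty_subset X.1

namespace IsSimplicial

variable {P Q : Set (Space 3)} {V V' : Finset (Space 3)} {F F' : Finset (Finset (Space 3))}

lemma isAtom_faces_iff (h : IsSimplicial P V F) (X : faces P) :
    IsAtom X ↔ ∃ v ∈ V, X.1 = {v} := by
  constructor
  · intro hX
    have hne : X.1.Nonempty := by
      rw [Set.nonempty_iff_ne_empty]
      exact fun he => hX.1 (Subtype.ext he)
    obtain ⟨W, l, c, hW, hf, hXW⟩ := h.exists_eq_convexHull X.2 hne
    have hWn : W.Nonempty := by
      rw [Finset.nonempty_iff_ne_empty]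
      rintro rfl
      simp [hXW] at hne
    obtain ⟨v, hv⟩ := hWn
    refine ⟨v, hW hv, ?_⟩
    have hle : (⟨{v}, h.isExposed_singleton (hW hv)⟩ : faces P) ≤ X := by
      change ({v} : Set (Space 3)) ⊆ X.1
      rw [hXW, Set.singleton_subset_iff]
      exact subset_convexHull ℝ _ hv
    rcases hX.le_iff.1 hle with hbot | heq
    · exact absurd (congrArg Subtype.val hbot) (Set.singleton_ne_empty v)
    · exact (congrArg Subtype.val heq).symm
  · rintro ⟨v, hv, hX⟩
    refine ⟨fun hbot => Set.singleton_ne_empty v (hX ▸ congrArg Subtype.val hbot), fun Y hY => ?_⟩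
    have hYX : Y.1 ⊂ {v} := hX ▸ hY
    exact Subtype.ext (Set.ssubset_singleton_iff.1 hYX)

lemma ncard_isAtom_faces (h : IsSimplicial P V F) : {X : faces P | IsAtom X}.ncard = V.card := by
  rw [← Set.ncard_coe_finset, ← Set.ncard_image_of_injective _ Subtype.val_injective,
    ← Set.ncard_image_of_injective (V : Set (Space 3)) (Set.singleton_injective)]
  congr 1
  ext G
  constructor
  · rintro ⟨X, hX, rfl⟩
    obtain ⟨v, hv, hXv⟩ := (h.isAtom_faces_iff X).1 hX
    exact ⟨v, hv, hXv.symm⟩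
  · rintro ⟨v, hv, rfl⟩
    exact ⟨⟨{v}, h.isExposed_singleton hv⟩, (h.isAtom_faces_iff _).2 ⟨v, hv, rfl⟩, rfl⟩

/-- Order isomorphisms preserve atoms, and the atoms are the vertices. -/
lemma card_eq_of_combEquiv (h : IsSimplicial P V F) (h' : IsSimplicial Q V' F')
    (hPQ : CombEquiv P Q) : V.card = V'.card := by
  obtain ⟨e⟩ := hPQ
  rw [← h.ncard_isAtom_faces, ← h'.ncard_isAtom_faces, ← Set.ncard_image_of_injective _ e.injective]
  congr 1
  ext Y
  constructor
  · rintro ⟨X, hX, rfl⟩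
    exact (e.isAtom_iff X).2 hX
  · intro hY
    exact ⟨e.symm Y, (e.symm.isAtom_iff Y).2 hY, e.apply_symm_apply Y⟩

lemma skeleton_adj_iff (h : IsSimplicial P V F) (u w : vertices P) :
    (skeleton P).Adj u w ↔ u ≠ w ∧ Linked F (u : Space 3) w := by
  have hu : (u : Space 3) ∈ V := Finset.mem_coe.1 (h.vertices_eq.subset u.2)
  have hw : (w : Space 3) ∈ V := Finset.mem_coe.1 (h.vertices_eq.subset w.2)
  exact and_congr_right fun huw => h.linked_iff (fun heq => huw (Subtype.ext heq)) hu hw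

lemma isKConnected_three (h : IsSimplicial P V F) (hc : LinkConnected V F) :
    IsKConnected (skeleton P) 3 := by
  classical
  have hV : ∀ x, x ∈ V ↔ x ∈ vertices P := fun x => by rw [h.vertices_eq, Finset.mem_coe]
  refine ⟨?_, fun S hS => ?_⟩
  · change ((3 : ℕ) : ℕ∞) < (vertices P).encard
    rw [h.vertices_eq, Set.encard_coe_eq_coe_finsetCard]
    exact_mod_cast h.four_le
  · have hSc : (S.image Subtype.val).card < 3 := Finset.card_image_le.trans_lt hS
    have hmem : ∀ x : vertices P, (x : Space 3) ∈ S.image Subtype.val ↔ x ∈ S := fun x => by simp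
    have hreach : ∀ (x : ((S : Set (vertices P))ᶜ : Set (vertices P))) (b : Space 3),
        Relation.ReflTransGen (fun u w => u ∉ S.image Subtype.val ∧ w ∉ S.image Subtype.val ∧
          Linked F u w) x.1.1 b → ∀ (hb : b ∈ vertices P) (hbS : (⟨b, hb⟩ : vertices P) ∉ S),
          ((skeleton P).induce ((S : Set (vertices P))ᶜ)).Reachable x ⟨⟨b, hb⟩, hbS⟩ := by
      intro x b hxb
      induction hxb with
      | refl => exact fun _ _ => SimpleGraph.Reachable.refl _
      | @tail b d _ hbd ih =>
        intro hd hdS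
        obtain ⟨hbS, -, hlink⟩ := hbd
        have hb : b ∈ vertices P := (hV b).1 (h.pair_subset hlink (by simp))
        have hbS' : (⟨b, hb⟩ : vertices P) ∉ S := fun hb' => hbS ((hmem ⟨b, hb⟩).2 hb')
        refine (ih hb hbS').trans ?_
        -- `Linked` also relates a vertex to itself, so a step may be stationary.
        by_cases hbd : b = d
        · subst hbd
          exact SimpleGraph.Reachable.refl _
        · refine SimpleGraph.Adj.reachable ?_
          rw [SimpleGraph.comap_adj]
          exact (h.skeleton_adj_iff _ _).2 ⟨fun heq => hbd (congrArg Subtype.val heq), hlink⟩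
    have : Nonempty ((S : Set (vertices P))ᶜ : Set (vertices P)) := by
      obtain ⟨x, hx, hxS⟩ := Finset.exists_mem_notMem_of_card_lt_card
        (show (S.image Subtype.val).card < V.card by have := h.four_le; omega)
      exact ⟨⟨⟨x, (hV x).1 hx⟩, fun hx' => hxS ((hmem ⟨x, _⟩).2 hx')⟩⟩
    refine ⟨fun x y => hreach x y.1.1 (hc _ hSc _ ?_ _ ?_) y.1.2 y.2⟩
    · exact Finset.mem_sdiff.2 ⟨(hV _).2 x.1.2, fun hx => x.2 ((hmem _).1 hx)⟩
    · exact Finset.mem_sdiff.2 ⟨(hV _).2 y.1.2, fun hy => y.2 ((hmem _).1 hy)⟩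

/-- If all neighbours of a vertex `v` lie in a set of at most three vertices, and there is a further
vertex, then the graph is not `4`-connected. -/
lemma not_isKConnected_four (h : IsSimplicial P V F) {t : Finset (Space 3)} (ht : t.card = 3)
    {v w : Space 3} (hv : v ∈ V) (hw : w ∈ V) (hvw : v ≠ w) (hvt : v ∉ t) (hwt : w ∉ t)
    (hN : ∀ x, Linked F v x → x ≠ v → x ∈ t) : ¬ IsKConnected (skeleton P) 4 := by
  classical
  rintro ⟨-, hconn⟩
  have hV : ∀ x, x ∈ V → x ∈ vertices P := fun x hx => by rwa [h.vertices_eq]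
  have hSc : (t.subtype fun x => x ∈ vertices P).card < 4 := by
    rw [Finset.card_subtype]
    exact (Finset.card_filter_le _ _).trans_lt (by omega)
  obtain ⟨hpre⟩ := hconn _ hSc
  obtain ⟨p⟩ := hpre ⟨⟨v, hV v hv⟩, by simpa using hvt⟩ ⟨⟨w, hV w hw⟩, by simpa using hwt⟩
  -- The first step of a path away from `v` would enter `t`, which has been deleted.
  cases p with
  | nil => exact hvw rfl
  | @cons _ x _ hadj _ =>
    rw [SimpleGraph.comap_adj] at hadj
    obtain ⟨hne, hlink⟩ := (h.skeleton_adj_iff _ _).1 hadj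
    have hxt := hN _ hlink fun heq => hne (Subtype.ext heq.symm)
    have := x.2
    simp only [Set.mem_compl_iff, Finset.mem_coe, Finset.mem_subtype] at this
    exact this hxt

end IsSimplicial

lemma slice_neg (l : Space 3 →L[ℝ] ℝ) (c : ℝ) : {x | (-l) x = -c} = {x | l x = c} := by
  ext x
  simp

/-! ### The gap at 4, and the iterates. -/

namespace IsStacked

variable {P Q : Set (Space 3)} {V V' : Finset (Space 3)} {F F' : Finset (Finset (Space 3))}
  {apex : Finset (Space 3) → Space 3}

/-- After stacking on all facets, the ends of an old edge have four common neighbours. -/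
lemma exists_common_neighbors (h : IsStacked P V F)
    (hF' : ∀ s, s ∈ F' ↔ ∃ t ∈ F, s ∈ coneFacets t (apex t))
    (hinj : ∀ s ∈ F, ∀ t ∈ F, apex s = apex t → s = t) (hapex : ∀ t ∈ F, apex t ∉ V)
    {u w : Space 3} (hl : Linked F u w) :
    ∃ N : Finset (Space 3), N.card = 4 ∧
      ∀ i ∈ N, Linked F' u i ∧ Linked F' w i ∧ i ≠ u ∧ i ≠ w := by
  have hsub : ∀ t ∈ F, coneFacets t (apex t) ⊆ F' := fun t ht s hs => (hF' s).2 ⟨t, ht, hs⟩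
  obtain ⟨t, ht, hu, hw⟩ := hl
  have htc := h.card_facet t ht
  obtain ⟨x, hx, hxu, hxw⟩ := exists_mem_ne_ne htc u w
  obtain ⟨s, hs, hts⟩ := h.neighbor t ht x hx
  have hsc := h.card_facet s hs
  have hus : u ∈ s := (Finset.mem_inter.1 (hts ▸ Finset.mem_erase.2 ⟨hxu.symm, hu⟩)).2
  have hws : w ∈ s := (Finset.mem_inter.1 (hts ▸ Finset.mem_erase.2 ⟨hxw.symm, hw⟩)).2
  have hxs := h.notMem_of_inter_eq hx hts
  have hst := h.ne_of_inter_eq hx hts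
  obtain ⟨y, hy, hyu, hyw⟩ := exists_mem_ne_ne hsc u w
  have hxV := h.subset t ht hx
  have hyV := h.subset s hs hy
  have huV := h.subset t ht hu
  have hwV := h.subset t ht hw
  have hne : ∀ r ∈ F, ∀ z ∈ V, z ≠ apex r := fun r hr z hz heq => hapex r hr (heq ▸ hz)
  refine ⟨{x, y, apex t, apex s}, ?_, ?_⟩
  · rw [Finset.card_insert_of_notMem, Finset.card_insert_of_notMem,
      Finset.card_pair fun heq => hst (hinj t ht s hs heq).symm]
    · simp [hne t ht y hyV, hne s hs y hyV]
    · have : x ≠ y := fun heq => hxs (heq ▸ hy)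
      simp [this, hne t ht x hxV, hne s hs x hxV]
  · intro i hi
    simp only [Finset.mem_insert, Finset.mem_singleton] at hi
    rcases hi with rfl | rfl | rfl | rfl
    · exact ⟨(linked_coneFacets htc hu hx).mono (hsub t ht),
        (linked_coneFacets htc hw hx).mono (hsub t ht), hxu, hxw⟩
    · exact ⟨(linked_coneFacets hsc hus hy).mono (hsub s hs),
        (linked_coneFacets hsc hws hy).mono (hsub s hs), hyu, hyw⟩
    · exact ⟨(linked_coneFacets_apex htc hu).symm.mono (hsub t ht),
        (linked_coneFacets_apex htc hw).symm.mono (hsub t ht),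
        (hne t ht u huV).symm, (hne t ht w hwV).symm⟩
    · exact ⟨(linked_coneFacets_apex hsc hus).symm.mono (hsub s hs),
        (linked_coneFacets_apex hsc hws).symm.mono (hsub s hs),
        (hne s hs u huV).symm, (hne s hs w hwV).symm⟩

/-- The slices by planes that do not strictly separate vertices of the original polytope. -/
lemma ncard_le_three_of_forall_le (h : IsStacked P V F) (hQ : IsStacked Q V' F')
    (hV' : ∀ x, x ∈ V' ↔ x ∈ V ∨ ∃ t ∈ F, apex t = x)
    (hF' : ∀ s, s ∈ F' ↔ ∃ t ∈ F, s ∈ coneFacets t (apex t)) (hapex : ∀ t ∈ F, apex t ∉ V)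
    {l : Space 3 →L[ℝ] ℝ} {c : ℝ} (hl : l ≠ 0) (hle : ∀ x ∈ V, c ≤ l x) :
    (vertices ({x | l x = c} ∩ Q)).ncard ≤ 3 := by
  by_cases hneg : ∃ x ∈ V', l x < c
  · obtain ⟨x, hx, hxc⟩ := hneg
    rcases (hV' x).1 hx with hxV | ⟨t, ht, rfl⟩
    · exact absurd hxc (hle x hxV).not_gt
    · exact hQ.ncard_le_three_of_apex_lt (h.card_facet t ht)
        (fun a ha => (hV' a).2 (Or.inl (h.subset t ht ha)))
        (fun hat => hapex t ht (h.subset t ht hat)) (fun s hs => (hF' s).2 ⟨t, ht, hs⟩) hxc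
        fun a ha => hle a (h.subset t ht ha)
  · push Not at hneg
    rw [← slice_neg]
    exact hQ.ncard_le_three_of_le (neg_ne_zero.2 hl) fun x hx => by simpa using hneg x hx

/-- The case split is on vertices of the old polytope: only its edges are known to have four common
neighbours for their ends. -/
lemma ncard_le_three_or_five_le (h : IsStacked P V F) (hQ : IsStacked Q V' F')
    (hV' : ∀ x, x ∈ V' ↔ x ∈ V ∨ ∃ t ∈ F, apex t = x)
    (hF' : ∀ s, s ∈ F' ↔ ∃ t ∈ F, s ∈ coneFacets t (apex t))
    (hinj : ∀ s ∈ F, ∀ t ∈ F, apex s = apex t → s = t) (hapex : ∀ t ∈ F, apex t ∉ V)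
    {l : Space 3 →L[ℝ] ℝ} {c : ℝ} (hl : l ≠ 0) :
    (vertices ({x | l x = c} ∩ Q)).ncard ≤ 3 ∨ 5 ≤ (vertices ({x | l x = c} ∩ Q)).ncard := by
  have hlink : ∀ {a b}, Linked F a b → Linked F' a b := by
    rintro a b ⟨t, ht, ha, hb⟩
    exact (linked_coneFacets (h.card_facet t ht) ha hb).mono fun s hs => (hF' s).2 ⟨t, ht, hs⟩
  by_cases hneg : ∃ w ∈ V, l w < c
  · by_cases hpos : ∃ u ∈ V, c < l u
    · rcases h.crosses l c hpos hneg with ⟨u, w, huw, hu, hw⟩ | ⟨t, htc, htl, hlk⟩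
      · right
        obtain ⟨N, hN, hNl⟩ := h.exists_common_neighbors hF' hinj hapex huw
        have := hQ.card_add_one_le_ncard (hlink huw) hu hw hNl
        omega
      · obtain ⟨u, -, hu⟩ := hpos
        exact Or.inl (hQ.ncard_le_three_of_triangle htc
          (fun a ha b hb => hlink (hlk a ha b hb)) htl hu.ne')
    · push Not at hpos
      left
      rw [← slice_neg]
      exact h.ncard_le_three_of_forall_le hQ hV' hF' hapex (neg_ne_zero.2 hl)
        fun x hx => by simpa using hpos x hx
  · push Not at hneg
    exact Or.inl (h.ncard_le_three_of_forall_le hQ hV' hF' hapex hl hneg)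

lemma isGap_four (h : IsStacked P V F) (hPQ : IsAllFacetsStacking P Q) : IsGap Q 4 := by
  obtain ⟨V', F', apex, hQ, hV', hF', hinj, hapex, -⟩ := h.of_isAllFacetsStacking hPQ
  have hbdd : BddAbove (VSS Q) := by
    refine ⟨F'.powerset.card, ?_⟩
    rintro k ⟨H, ⟨l, c, -, rfl⟩, -, rfl⟩
    exact (hQ.slice_finite l c).2
  have hfive : ∃ k ∈ VSS Q, 5 ≤ k := by
    obtain ⟨t, ht⟩ := h.facets_nonempty
    have htc := h.card_facet t ht
    obtain ⟨u, hu⟩ := Finset.card_pos.1 (show 0 < t.card by omega)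
    obtain ⟨w, hw, hwu, -⟩ := exists_mem_ne_ne htc u u
    have hlk : Linked F u w := ⟨t, ht, hu, hw⟩
    obtain ⟨N, hN, hNl⟩ := h.exists_common_neighbors hF' hinj hapex hlk
    -- The perpendicular bisector of an old edge crosses it and gives a slice with at least 5
    -- vertices, so 4 does not exceed the maximum.
    let l : Space 3 →L[ℝ] ℝ := innerSL ℝ (u - w)
    have hlt : l w < l u := by
      rw [← sub_pos, ← map_sub]
      have hpos : 0 < ‖u - w‖ := norm_pos_iff.2 (sub_ne_zero.2 hwu.symm)
      have hl : l (u - w) = ‖u - w‖ ^ 2 := real_inner_self_eq_norm_sq (u - w)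
      rw [hl]
      positivity
    have hcu : (l u + l w) / 2 < l u := by linarith
    have hcw : l w < (l u + l w) / 2 := by linarith
    have hlk' : Linked F' u w :=
      (linked_coneFacets htc hu hw).mono fun s hs => (hF' s).2 ⟨t, ht, hs⟩
    have hcard := hQ.card_add_one_le_ncard hlk' hcu hcw hNl
    obtain ⟨z, hz⟩ := hQ.exists_isCut_pair hlk' hcu hcw
    refine ⟨_, ⟨_, ⟨l, _, ?_, rfl⟩, ⟨z, hz.mem_vertices.1⟩, rfl⟩, by omega⟩
    intro hl
    simp [hl] at hlt
  obtain ⟨k, hk, hk5⟩ := hfive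
  refine ⟨sSup (VSS Q), ⟨Nat.sSup_mem ⟨k, hk⟩ hbdd, fun _ hm => le_csSup hbdd hm⟩, by norm_num,
    by linarith [le_csSup hbdd hk], ?_⟩
  rintro ⟨H, ⟨l, c, hl, rfl⟩, -, hcard⟩
  rcases h.ncard_le_three_or_five_le hQ hV' hF' hinj hapex (c := c) hl with h3 | h5 <;> omega

/-- The neighbours of the apex over `t` are vertices of `t`; deleting `t` separates the apex from
any other old vertex. -/
lemma not_isKConnected_four (h : IsStacked P V F) (hPQ : IsAllFacetsStacking P Q) :
    ¬ IsKConnected (skeleton Q) 4 := by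
  obtain ⟨V', F', apex, hQ, hV', hF', hinj, hapex, -⟩ := h.of_isAllFacetsStacking hPQ
  obtain ⟨t, ht⟩ := h.facets_nonempty
  obtain ⟨w, hw, hwt⟩ := h.exists_apart ht
  refine hQ.toIsSimplicial.not_isKConnected_four (h.card_facet t ht)
    ((hV' _).2 (Or.inr ⟨t, ht, rfl⟩)) ((hV' w).2 (Or.inl hw)) (fun heq => hapex t ht (heq ▸ hw))
    (fun hat => hapex t ht (h.subset t ht hat)) hwt ?_
  rintro x ⟨s, hs, hvs, hxs⟩ hxv
  obtain ⟨r, hr, hsr⟩ := (hF' s).1 hs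
  obtain ⟨a, -, rfl⟩ := Finset.mem_image.1 hsr
  have hrt : t = r := by
    rcases Finset.mem_insert.1 hvs with heq | hmem
    · exact hinj t ht r hr heq
    · exact absurd (h.subset r hr (Finset.mem_of_mem_erase hmem)) (hapex t ht)
  subst hrt
  exact Finset.mem_of_mem_erase ((Finset.mem_insert.1 hxs).resolve_left hxv)

/-- The count solves the recursion from `V` to `V + (2V - 4)`, started at 4. -/
lemma of_isIteratedStacking {T : Set (Space 3)} (hT : IsTetrahedron T) (n : ℕ) :
    ∀ P, IsIteratedStacking n T P → ∃ V F, IsStacked P V F ∧ V.card = 2 * 3 ^ n + 2 := by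
  induction n with
  | zero =>
    rintro P rfl
    obtain ⟨p, hp, rfl⟩ := hT
    refine ⟨_, _, isStacked_tetrahedron hp, ?_⟩
    rw [Finset.card_image_of_injective _ hp.injective]
    simp
  | succ n ih =>
    rintro Q ⟨P, hP, hPQ⟩
    obtain ⟨V, F, h, hcard⟩ := ih P hP
    obtain ⟨V', F', -, hQ, -, -, -, -, hcard'⟩ := h.of_isAllFacetsStacking hPQ
    refine ⟨V', F', hQ, ?_⟩
    have := h.card_eq
    rw [pow_succ]
    omega

end IsStacked

lemma exists_isIteratedStacking {T : Set (Space 3)} (hT : IsTetrahedron T) (n : ℕ) :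
    ∃ P, IsIteratedStacking n T P := by
  induction n with
  | zero => exact ⟨T, rfl⟩
  | succ n ih =>
    obtain ⟨P, hP⟩ := ih
    obtain ⟨V, F, h, -⟩ := IsStacked.of_isIteratedStacking hT n P hP
    obtain ⟨Q, hQ⟩ := h.exists_isAllFacetsStacking
    exact ⟨Q, P, hP, hQ⟩

lemma IsIteratedStacking.properties {T : Set (Space 3)} (hT : IsTetrahedron T) {n : ℕ}
    {P : Set (Space 3)} (hn : 1 ≤ n) (hP : IsIteratedStacking n T P) :
    IsPolytope P ∧ IsKConnected (skeleton P) 3 ∧ ¬ IsKConnected (skeleton P) 4 ∧ IsGap P 4 := by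
  obtain ⟨V, F, h, -⟩ := IsStacked.of_isIteratedStacking hT n P hP
  obtain ⟨m, rfl⟩ := Nat.exists_eq_add_of_le' hn
  obtain ⟨R, hR, hRP⟩ := hP
  obtain ⟨V₀, F₀, h₀, -⟩ := IsStacked.of_isIteratedStacking hT m R hR
  exact ⟨h.isPolytope, h.isKConnected_three h.linkConnected, h₀.not_isKConnected_four hRP,
    h₀.isGap_four hRP⟩

lemma not_combEquiv_of_isIteratedStacking {T : Set (Space 3)} (hT : IsTetrahedron T) {m n : ℕ}
    {P Q : Set (Space 3)} (hmn : m ≠ n) (hP : IsIteratedStacking m T P)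
    (hQ : IsIteratedStacking n T Q) : ¬ CombEquiv P Q := by
  obtain ⟨V, F, h, hV⟩ := IsStacked.of_isIteratedStacking hT m P hP
  obtain ⟨V', F', h', hV'⟩ := IsStacked.of_isIteratedStacking hT n Q hQ
  intro hPQ
  have := h.card_eq_of_combEquiv h'.toIsSimplicial hPQ
  exact hmn (Nat.pow_right_injective (le_refl 2 |>.trans (by norm_num : 2 ≤ 3)) (by
    change 3 ^ m = 3 ^ n
    omega))

lemma exists_isTetrahedron : ∃ T, IsTetrahedron T := by
  obtain ⟨b⟩ := AffineBasis.exists_affineBasis_of_finiteDimensional (ι := Fin 4) (k := ℝ)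
    (P := Space 3) (by simp)
  exact ⟨_, b, b.ind, rfl⟩

end SlicePolytope

theorem theorem3 :
    -- infinitely many combinatorial types of `3`-polytopes that are only `3`-connected have a gap
    (∃ X : Set (Set (SlicePolytope.Space 3)), X.Infinite ∧
      X.Pairwise (fun P Q => ¬ SlicePolytope.CombEquiv P Q) ∧
      ∀ P ∈ X, SlicePolytope.IsPolytope P ∧
        SlicePolytope.IsKConnected (SlicePolytope.skeleton P) 3 ∧
        ¬ SlicePolytope.IsKConnected (SlicePolytope.skeleton P) 4 ∧
        ∃ m, SlicePolytope.IsGap P m) ∧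
    -- the iterates `σ^n(T)`, for all tetrahedra and all choices of the new vertices
    (∀ T : Set (SlicePolytope.Space 3), SlicePolytope.IsTetrahedron T →
      (∀ n : ℕ, ∃ P, SlicePolytope.IsIteratedStacking n T P) ∧
      (∀ (n : ℕ) (P : Set (SlicePolytope.Space 3)), 1 ≤ n →
        SlicePolytope.IsIteratedStacking n T P →
          SlicePolytope.IsPolytope P ∧
          SlicePolytope.IsKConnected (SlicePolytope.skeleton P) 3 ∧
          ¬ SlicePolytope.IsKConnected (SlicePolytope.skeleton P) 4 ∧
          SlicePolytope.IsGap P 4) ∧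
      (∀ (m n : ℕ) (P Q : Set (SlicePolytope.Space 3)), m ≠ n →
        SlicePolytope.IsIteratedStacking m T P → SlicePolytope.IsIteratedStacking n T Q →
          ¬ SlicePolytope.CombEquiv P Q)) := by
  open SlicePolytope in
  refine ⟨?_, fun T hT => ⟨exists_isIteratedStacking hT,
    fun n P hn hP => hP.properties hT hn,
    fun m n P Q hmn hP hQ => not_combEquiv_of_isIteratedStacking hT hmn hP hQ⟩⟩
  obtain ⟨T, hT⟩ := SlicePolytope.exists_isTetrahedron
  -- The shift skips the tetrahedron itself, since at least one round is needed.
  choose P hP using fun n => SlicePolytope.exists_isIteratedStacking hT (n + 1)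
  have hne : ∀ m n, m ≠ n → ¬ SlicePolytope.CombEquiv (P m) (P n) := fun m n hmn =>
    SlicePolytope.not_combEquiv_of_isIteratedStacking hT (by omega) (hP m) (hP n)
  refine ⟨Set.range P, Set.infinite_range_of_injective fun m n hmn => ?_, ?_, ?_⟩
  · by_contra hne'
    exact hne m n hne' (hmn ▸ ⟨OrderIso.refl _⟩)
  · rintro _ ⟨m, rfl⟩ _ ⟨n, rfl⟩ hmn
    exact hne m n fun heq => hmn (heq ▸ rfl)
  · rintro _ ⟨n, rfl⟩
    obtain ⟨h1, h2, h3, h4⟩ := (hP n).properties hT (by omega)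
    exact ⟨h1, h2, h3, 4, h4⟩
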